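/- Let $N\ge 0$ and $\beta\ge 0$ be integers and let $\gamma>-1/2$ be real. On $\mathbb C[z]=\mathbb C[z_1,\dots,z_N]$ let $s_{jk}$ exchange $z_j$ and $z_k$, let $t_j$ replace $z_j$ by $-z_j$, and consider the $B_N$-type Dunkl operators $$D_j=\frac{\partial}{\partial z_j}+\beta\sum_{k\ne j}\Big(\frac{1-s_{jk}}{z_j-z_k}+\frac{1-t_jt_ks_{jk}}{z_j+z_k}\Big)+\gamma\,\frac{1-t_j}{z_j},$$ the operators $\tilde b_j^\dagger=\frac1{\sqrt2}(2z_j-D_j)$, $\tilde b_j=\frac1{\sqrt2}D_j$, and the commuting operators $$\tilde h_j^B=\tilde b_j^\dagger\tilde b_j+\beta\sum_{k<j}(s_{jk}+t_jt_ks_{jk})\qquad(j=1,\dots,N).$$ Let $\varepsilon\in\{1,-1\}$ (either choice is allowed) and put $$\mathcal X_L=\prod_{i<j}(z_i^2-z_j^2),\quad \mathcal Y_L=\prod_{i<j}\Big(\varepsilon\beta-\tfrac12\tilde h_i^B+\tfrac12\tilde h_j^B\Big),\quad \hat{\mathcal Y}_L=\prod_{i<j}\Big(-\varepsilon\beta-\tfrac12\tilde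 h_i^B+\tfrac12\tilde h_j^B\Big),$$ $$G_L=\mathcal X_L^{-1}\mathcal Y_L,\qquad \hat G_L=\hat{\mathcal Y}_L\,\mathcal X_L .$$ Here $\beta$ is the same in $D_j,\tilde h^B_j,\mathcal Y_L,\hat{\mathcal Y}_L$, and $G_Lf$ is regarded as the function $\mathcal X_L^{-1}\cdot(\mathcal Y_Lf)$ on the set $\mathcal X_L\neq0$ of full measure in $\mathbb R^N$. For an integer $b\ge0$ let $$\langle F,H\rangle_L^{(b)}=\int_{\mathbb R^N}F(z)H(z)\prod_{j<k}|z_j^2-z_k^2|^{2b}\prod_{j=1}^N|z_j|^{2\gamma}e^{-z_j^2}\,dz_1\cdots dz_N .$$ Then for all $f,g\in\mathbb C[z_1^2,\dots,z_N^2]^{S_N}$ the integrals defining the two sides below converge absolutely, and $$\langle G_Lf,g\rangle_L^{(\beta+1)}=\langle f,\hat G_Lg\rangle_L^{(\beta)} .$$ -/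

import Mathlib

open MvPolynomial MeasureTheory

namespace Laguerre

noncomputable section

/-- The polynomial ring `ℂ[z_1, …, z_N]`. -/
abbrev Poly (N : ℕ) := MvPolynomial (Fin N) ℂ

variable {N : ℕ}

/-- If `d` divides `X i - w (X i)` for every variable, then `d` divides `f - w f` for every `f`. -/
theorem dvd_sub_of_forall_X (w : Poly N →ₐ[ℂ] Poly N) (d : Poly N)
    (h : ∀ i, d ∣ X i - w (X i)) (f : Poly N) : d ∣ f - w f := by
  induction f using MvPolynomial.induction_on with
  | C a =>
    have h1 : w (C a) = C a := w.commutes a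
    simp [h1]
  | add p q hp hq =>
    have h1 : p + q - w (p + q) = (p - w p) + (q - w q) := by rw [map_add]; ring
    rw [h1]; exact dvd_add hp hq
  | mul_X p i hp =>
    have h1 : p * X i - w (p * X i) = (p - w p) * X i + w p * (X i - w (X i)) := by
      rw [map_mul]; ring
    rw [h1]; exact dvd_add (hp.mul_right _) ((h i).mul_left _)

/-- The divided difference operator `f ↦ (f - w f) / d` on polynomials: its value at `f` is the
unique polynomial `q` with `f - w f = d * q`. -/
def divDiff (w : Poly N →ₐ[ℂ] Poly N) (d : Poly N) (hd : d ≠ 0)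
    (h : ∀ i, d ∣ X i - w (X i)) : Module.End ℂ (Poly N) where
  toFun f := (dvd_sub_of_forall_X w d h f).choose
  map_add' f g := by
    apply mul_left_cancel₀ hd
    rw [mul_add, ← (dvd_sub_of_forall_X w d h (f + g)).choose_spec,
      ← (dvd_sub_of_forall_X w d h f).choose_spec, ← (dvd_sub_of_forall_X w d h g).choose_spec,
      map_add]
    ring
  map_smul' c f := by
    apply mul_left_cancel₀ hd
    rw [RingHom.id_apply, mul_smul_comm, ← (dvd_sub_of_forall_X w d h (c • f)).choose_spec,
      ← (dvd_sub_of_forall_X w d h f).choose_spec, map_smul, smul_sub]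

theorem mul_divDiff (w : Poly N →ₐ[ℂ] Poly N) (d : Poly N) (hd : d ≠ 0)
    (h : ∀ i, d ∣ X i - w (X i)) (f : Poly N) : d * divDiff w d hd h f = f - w f :=
  (dvd_sub_of_forall_X w d h f).choose_spec.symm

/-- `s_{jk}`: exchange of the arguments `z_j` and `z_k`. -/
def swapHom (j k : Fin N) : Poly N →ₐ[ℂ] Poly N := rename (Equiv.swap j k)

/-- `t_j`: replacement of `z_j` by `-z_j`. -/
def signHom (j : Fin N) : Poly N →ₐ[ℂ] Poly N := aeval fun i => if i = j then -X i else X i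

/-- `t_j t_k s_{jk}`. -/
def signSwapHom (j k : Fin N) : Poly N →ₐ[ℂ] Poly N :=
  (signHom j).comp ((signHom k).comp (swapHom j k))

theorem X_sub_X_ne_zero {j k : Fin N} (hk : k ≠ j) : (X j - X k : Poly N) ≠ 0 := fun h =>
  hk (X_injective (sub_eq_zero.mp h)).symm

theorem X_add_X_ne_zero {j k : Fin N} (hk : k ≠ j) : (X j + X k : Poly N) ≠ 0 := fun h => by
  have h1 := congrArg (eval fun i => if i = j then (1 : ℂ) else 0) h
  simp [hk] at h1

theorem swap_dvd (j k i : Fin N) : (X j - X k : Poly N) ∣ X i - swapHom j k (X i) := by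
  simp only [swapHom, rename_X, Equiv.swap_apply_def]
  split_ifs with h1 h2
  · rw [h1]
  · rw [h2]; exact ⟨-1, by ring⟩
  · simp

theorem signSwap_dvd {j k : Fin N} (hk : k ≠ j) (i : Fin N) :
    (X j + X k : Poly N) ∣ X i - signSwapHom j k (X i) := by
  simp only [signSwapHom, swapHom, signHom, AlgHom.comp_apply, rename_X, Equiv.swap_apply_def]
  split_ifs with h1 h2
  · subst h1; simp [hk]
  · subst h2; simp [hk.symm, add_comm]
  · simp [h1, h2]

theorem sign_dvd (j i : Fin N) : (X j : Poly N) ∣ X i - signHom j (X i) := by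
  by_cases h : i = j
  · subst h; simp [signHom]
  · simp [signHom, h]

/-- `f ↦ (f - s_{jk} f) / (z_j - z_k)`. -/
def swapQuot (j k : Fin N) (hk : k ≠ j) : Module.End ℂ (Poly N) :=
  divDiff (swapHom j k) (X j - X k) (X_sub_X_ne_zero hk) (swap_dvd j k)

/-- `f ↦ (f - t_j t_k s_{jk} f) / (z_j + z_k)`. -/
def signSwapQuot (j k : Fin N) (hk : k ≠ j) : Module.End ℂ (Poly N) :=
  divDiff (signSwapHom j k) (X j + X k) (X_add_X_ne_zero hk) (signSwap_dvd hk)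

/-- `f ↦ (f - t_j f) / z_j`. -/
def signQuot (j : Fin N) : Module.End ℂ (Poly N) :=
  divDiff (signHom j) (X j) (MvPolynomial.X_ne_zero j) (sign_dvd j)

/-- The Dunkl operator of type `B_N`,
`D_j = ∂_j + β ∑_{k ≠ j} ((1 - s_{jk}) / (z_j - z_k) + (1 - t_j t_k s_{jk}) / (z_j + z_k))
  + γ (1 - t_j) / z_j`. -/
def dunkl (β : ℕ) (γ : ℝ) (j : Fin N) : Module.End ℂ (Poly N) :=
  (pderiv j : Derivation ℂ (Poly N) (Poly N)).toLinearMap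
    + (β : ℂ) • ∑ k : {k : Fin N // k ≠ j}, (swapQuot j k.1 k.2 + signSwapQuot j k.1 k.2)
    + (γ : ℂ) • signQuot j

/-- Multiplication by the polynomial `p`. -/
def mulOp (p : Poly N) : Module.End ℂ (Poly N) := LinearMap.mulLeft ℂ p

/-- The creation operator `(2 z_j - D_j) / √2`, which is the conjugate of `(-D_j + z_j) / √2` by
`∏ exp (-z_k ^ 2 / 2)`. -/
def bDag (β : ℕ) (γ : ℝ) (j : Fin N) : Module.End ℂ (Poly N) :=
  ((√2 : ℝ) : ℂ)⁻¹ • (mulOp (2 * X j) - dunkl β γ j)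

/-- The annihilation operator `D_j / √2`, which is the conjugate of `(D_j + z_j) / √2` by
`∏ exp (-z_k ^ 2 / 2)`. -/
def bAnn (β : ℕ) (γ : ℝ) (j : Fin N) : Module.End ℂ (Poly N) :=
  ((√2 : ℝ) : ℂ)⁻¹ • dunkl β γ j

/-- The commuting operators `h_j = b†_j b_j + β ∑_{k < j} (s_{jk} + t_j t_k s_{jk})`. -/
def hB (β : ℕ) (γ : ℝ) (j : Fin N) : Module.End ℂ (Poly N) :=
  bDag β γ j * bAnn β γ j
    + (β : ℂ) • ∑ k ∈ Finset.univ.filter (fun k : Fin N => k < j),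
        ((swapHom j k).toLinearMap + (signSwapHom j k).toLinearMap)

/-- All pairs `(i, j)` with `i < j`, in lexicographic order. -/
def pairList (N : ℕ) : List (Fin N × Fin N) :=
  (List.finRange N ×ˢ List.finRange N).filter fun p => p.1 < p.2

/-- `𝒳 = ∏_{i < j} (z_i ^ 2 - z_j ^ 2)`. -/
def XL (N : ℕ) : Poly N :=
  ∏ p ∈ Finset.univ.filter (fun p : Fin N × Fin N => p.1 < p.2), (X p.1 ^ 2 - X p.2 ^ 2)

/-- `∏_{i < j} (c - h_i / 2 + h_j / 2)`. The `h_j` commute, so the order of the factors, which is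
fixed here as the lexicographic one, is immaterial. -/
def YL (β : ℕ) (γ : ℝ) (c : ℂ) : Module.End ℂ (Poly N) :=
  ((pairList N).map fun p =>
    c • (1 : Module.End ℂ (Poly N)) - (1 / 2 : ℂ) • hB β γ p.1 + (1 / 2 : ℂ) • hB β γ p.2).prod

/-- The function on `ℝ ^ N` given by a polynomial. -/
def toFn (p : Poly N) (z : Fin N → ℝ) : ℂ := eval (fun i => (z i : ℂ)) p

/-- `G f = 𝒳⁻¹ 𝒴 f` with `𝒴 = ∏_{i < j} (c - h_i / 2 + h_j / 2)`, as a function on `ℝ ^ N`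
(meaningful off the null set where `𝒳` vanishes). -/
def shiftG (β : ℕ) (γ : ℝ) (c : ℂ) (f : Poly N) (z : Fin N → ℝ) : ℂ :=
  (toFn (XL N) z)⁻¹ * toFn (YL β γ c f) z

/-- `Ĝ = 𝒴 𝒳` with `𝒴 = ∏_{i < j} (c - h_i / 2 + h_j / 2)`. -/
def shiftGHat (β : ℕ) (γ : ℝ) (c : ℂ) : Module.End ℂ (Poly N) :=
  YL β γ c * mulOp (XL N)

/-- The ground state
`φ(z) = ∏_{j < k} |z_j ^ 2 - z_k ^ 2| ^ β * ∏_j |z_j| ^ γ * exp (-z_j ^ 2 / 2)`. -/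
def groundState (β : ℕ) (γ : ℝ) (z : Fin N → ℝ) : ℝ :=
  (∏ p ∈ Finset.univ.filter (fun p : Fin N × Fin N => p.1 < p.2), |z p.1 ^ 2 - z p.2 ^ 2| ^ β)
    * ∏ j, (|z j| ^ γ * Real.exp (-(z j) ^ 2 / 2))

/-- The integrand of the scalar product. -/
def integrandL (β : ℕ) (γ : ℝ) (F G : (Fin N → ℝ) → ℂ) (z : Fin N → ℝ) : ℂ :=
  F z * G z * ((groundState β γ z ^ 2 : ℝ) : ℂ)

/-- The (bilinear) scalar product `⟨F, G⟩ = ∫ F(z) G(z) φ(z) ^ 2 dz` over `ℝ ^ N`. -/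
def innerL (β : ℕ) (γ : ℝ) (F G : (Fin N → ℝ) → ℂ) : ℂ :=
  ∫ z : Fin N → ℝ, integrandL β γ F G z

/-- `ℂ[z_1 ^ 2, …, z_N ^ 2] ^ {S_N}`: the symmetric polynomials in the squares of the variables. -/
def evenSymm (N : ℕ) : Subalgebra ℂ (Poly N) :=
  Algebra.adjoin ℂ (Set.range fun i : Fin N => (X i : Poly N) ^ 2) ⊓ symmetricSubalgebra (Fin N) ℂ

end

end Laguerre

open MvPolynomial MeasureTheory

namespace Laguerre

variable {N : ℕ}

/-! Write `L p` for the integral of a polynomial against `∏ |z_j|^(2γ) exp(-z_j²)`, and put `W =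
𝒳^(2β)`. The weight for `β + 1` is `𝒳²` times the weight for `β`, so one factor `𝒳` cancels the
`𝒳⁻¹` in `G`. With `A = 𝒳 g` the claim becomes `L(𝒴_c f · A · W) = L(f · 𝒴_{c'} A · W)` for `c =
εβ`, `c' = -εβ`. It holds for all constants `c`, `c'`.

First, `𝒴_c` moves across. For the form `L(f g W)` the adjoint of `D_j` is `2z_j - D_j`, so `b†_j
b_j` is symmetric. The reflections are symmetric too, hence so is each `h_j` (`hB_form`). It remains
to see that `L(f · 𝒴_c A · W)` does not depend on `c`.

Since the `h_j` commute (`hB_commute`), `ℓ(p) = L(f · p(h/2) A · W)` is a linear functional of the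
polynomial `p`. The `h_j` and the adjacent transpositions `s` satisfy degenerate affine Hecke
relations, so `p(h/2)` commutes with `s` whenever `s p = p` (`swap_commute_aeval`). As `f` and `W`
are symmetric and `A` is antisymmetric, the integrand then changes sign under `s`, and `ℓ(p) = 0`.
Applied to `p + s p`, this shows that `ℓ` is alternating. It therefore kills every monomial with two
equal exponents, in particular everything of degree below `N(N-1)/2`. Two polynomials `∏_{i<j} (c -
x_i + x_j)` with different `c` share their top-degree part, so `ℓ` agrees on them
(`map_shiftPoly_eq`). -/

/-! ### Divided differences under algebra maps. -/

theorem divDiff_mul (w : Poly N →ₐ[ℂ] Poly N) (d : Poly N) (hd : d ≠ 0)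
    (h : ∀ i, d ∣ X i - w (X i)) (p q : Poly N) :
    divDiff w d hd h (p * q) = p * divDiff w d hd h q + divDiff w d hd h p * w q := by
  apply mul_left_cancel₀ hd
  have h1 := mul_divDiff w d hd h p
  have h2 := mul_divDiff w d hd h q
  rw [mul_divDiff, map_mul]
  linear_combination -(p : Poly N) * h2 - w q * h1

theorem divDiff_eq_of_mul_eq {w : Poly N →ₐ[ℂ] Poly N} {d : Poly N} (hd : d ≠ 0)
    (h : ∀ i, d ∣ X i - w (X i)) {p q : Poly N} (hq : d * q = p - w p) :
    divDiff w d hd h p = q :=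
  mul_left_cancel₀ hd ((mul_divDiff w d hd h p).trans hq.symm)

/-- Applying `u` to `d * q = f - w f` gives the defining equation of the other quotient. All
equivariance statements for the Dunkl operators come from this, with `c = 1` or `c = -1`. -/
theorem map_divDiff (u w w' : Poly N →ₐ[ℂ] Poly N) (d d' : Poly N) (hd : d ≠ 0) (hd' : d' ≠ 0)
    (h : ∀ i, d ∣ X i - w (X i)) (h' : ∀ i, d' ∣ X i - w' (X i)) (c : ℂ)
    (hw : u.comp w = w'.comp u) (hud : u d = c • d') (f : Poly N) :
    divDiff w' d' hd' h' (u f) = c • u (divDiff w d hd h f) := by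
  apply divDiff_eq_of_mul_eq
  have h1 := congrArg u (mul_divDiff w d hd h f)
  have h2 : u (w f) = w' (u f) := DFunLike.congr_fun hw f
  rw [map_mul, map_sub, hud, h2] at h1
  rw [← h1, mul_smul_comm, smul_mul_assoc]

/-! ### Relations among permutations and sign changes. -/

theorem signHom_X (j i : Fin N) :
    signHom j (X i : Poly N) = if i = j then -X i else X i := by
  simp [signHom]

theorem swapHom_X (j k i : Fin N) :
    swapHom j k (X i : Poly N) = X (Equiv.swap j k i) := by
  simp [swapHom]

theorem signSwapHom_X (j k i : Fin N) :
    signSwapHom j k (X i : Poly N) = signHom j (signHom k (X (Equiv.swap j k i))) := by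
  simp [signSwapHom, swapHom_X]

/-- The permutation of the variables by `π`, as an operator. -/
noncomputable def permOp (π : Equiv.Perm (Fin N)) : Module.End ℂ (Poly N) :=
  (rename π : Poly N →ₐ[ℂ] Poly N).toLinearMap

/-- The operator `t_j`. -/
noncomputable def signOp (j : Fin N) : Module.End ℂ (Poly N) := (signHom j).toLinearMap

/-- The operator `s_{jk} + t_j t_k s_{jk}`. -/
noncomputable def pairOp (j k : Fin N) : Module.End ℂ (Poly N) :=
  (swapHom j k).toLinearMap + (signSwapHom j k).toLinearMap

theorem swapHom_toLinearMap (j k : Fin N) :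
    (swapHom j k).toLinearMap = permOp (Equiv.swap j k) := rfl

theorem signSwapHom_toLinearMap (j k : Fin N) :
    (signSwapHom j k).toLinearMap = signOp j * signOp k * permOp (Equiv.swap j k) := rfl

theorem permOp_mul (π ρ : Equiv.Perm (Fin N)) : permOp (π * ρ) = permOp π * permOp ρ := by
  refine LinearMap.ext fun f => ?_
  simp [permOp, rename_rename]

theorem permOp_one : permOp (1 : Equiv.Perm (Fin N)) = 1 := by
  refine LinearMap.ext fun f => ?_
  simp [permOp]

theorem permOp_swap_mul_self (j k : Fin N) :
    permOp (Equiv.swap j k) * permOp (Equiv.swap j k) = 1 := by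
  rw [← permOp_mul, Equiv.swap_mul_self, permOp_one]

theorem signOp_mul_self (j : Fin N) : signOp j * signOp j = 1 := by
  have : (signHom j).comp (signHom j) = AlgHom.id ℂ (Poly N) := by
    apply MvPolynomial.algHom_ext
    intro i
    by_cases h : i = j <;> simp [signHom_X, h]
  exact congrArg AlgHom.toLinearMap this

theorem signOp_comm (i j : Fin N) : Commute (signOp i) (signOp j) := by
  by_cases hij : i = j
  · rw [hij]
  have : (signHom i).comp (signHom j) = (signHom j).comp (signHom i) := by
    apply MvPolynomial.algHom_ext
    intro l
    simp only [AlgHom.comp_apply, signHom_X]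
    by_cases h : l = j
    · have h' : j ≠ i := Ne.symm hij
      simp [signHom_X, h, h']
    · by_cases h' : l = i <;> simp [signHom_X, h, h', hij]
  exact congrArg AlgHom.toLinearMap this

theorem permOp_mul_signOp (π : Equiv.Perm (Fin N)) (j : Fin N) :
    permOp π * signOp j = signOp (π j) * permOp π := by
  have : (rename π : Poly N →ₐ[ℂ] Poly N).comp (signHom j)
      = (signHom (π j)).comp (rename π) := by
    apply MvPolynomial.algHom_ext
    intro i
    by_cases h : i = j <;> simp [signHom_X, h]
  exact congrArg AlgHom.toLinearMap this

theorem pairOp_eq (j k : Fin N) :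
    pairOp j k = (1 + signOp j * signOp k) * permOp (Equiv.swap j k) := by
  rw [add_mul, one_mul]; rfl

theorem pairOp_symm (j k : Fin N) : pairOp j k = pairOp k j := by
  rw [pairOp_eq, pairOp_eq, Equiv.swap_comm, (signOp_comm j k).eq]

theorem permOp_mul_swap (π : Equiv.Perm (Fin N)) (j k : Fin N) :
    permOp π * permOp (Equiv.swap j k) = permOp (Equiv.swap (π j) (π k)) * permOp π := by
  rw [← permOp_mul, ← permOp_mul, Equiv.swap_apply_apply]
  simp

theorem permOp_mul_pairOp (π : Equiv.Perm (Fin N)) (j k : Fin N) :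
    permOp π * pairOp j k = pairOp (π j) (π k) * permOp π := by
  simp only [pairOp_eq, mul_add, add_mul, one_mul, ← mul_assoc, permOp_mul_signOp,
    permOp_mul_swap]
  simp only [mul_assoc]
  simp only [← mul_assoc, permOp_mul_signOp]
  simp only [mul_assoc, permOp_mul_swap]

/-- Conjugation by `t_j` or `t_k` exchanges the two reflections `s_{jk}` and `t_j t_k s_{jk}`; this
is why they occur in pairs in `D_j` and `h_j`. -/
theorem signOp_mul_swap_left (j k : Fin N) :
    signOp j * permOp (Equiv.swap j k)
      = signOp j * signOp k * permOp (Equiv.swap j k) * signOp j := by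
  rw [mul_assoc _ _ (signOp j), permOp_mul_signOp, Equiv.swap_apply_left, mul_assoc,
    ← mul_assoc (signOp k), signOp_mul_self, one_mul]

theorem signOp_mul_swap_right (j k : Fin N) :
    signOp k * permOp (Equiv.swap j k)
      = signOp j * signOp k * permOp (Equiv.swap j k) * signOp k := by
  rw [mul_assoc _ _ (signOp k), permOp_mul_signOp, Equiv.swap_apply_right, (signOp_comm j k).eq,
    mul_assoc, ← mul_assoc (signOp j), signOp_mul_self, one_mul]

theorem signOp_commute_swap {i j k : Fin N} (hj : i ≠ j) (hk : i ≠ k) :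
    Commute (signOp i) (permOp (Equiv.swap j k)) := by
  rw [Commute, SemiconjBy, permOp_mul_signOp, Equiv.swap_apply_of_ne_of_ne hj hk]

theorem signOp_commute_pairOp (i j k : Fin N) : Commute (signOp i) (pairOp j k) := by
  have key : ∀ i k : Fin N, Commute (signOp i) (pairOp i k) := fun i k => by
    have h := signOp_mul_swap_left i k
    rw [pairOp_eq, Commute, SemiconjBy, add_mul, one_mul, mul_add, add_mul, ← h, h,
      ← mul_assoc, ← mul_assoc, signOp_mul_self, one_mul, permOp_mul_signOp,
      Equiv.swap_apply_left, add_comm]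
  by_cases hj : i = j
  · subst hj; exact key i k
  by_cases hk : i = k
  · subst hk; rw [pairOp_symm]; exact key i j
  rw [pairOp_eq]
  exact (((Commute.one_right _).add_right ((signOp_comm i j).mul_right (signOp_comm i k)))).mul_right
    (signOp_commute_swap hj hk)

/-! ### Equivariance of the Dunkl operators under the group of type B. -/

theorem permOp_mul_swapQuot (π : Equiv.Perm (Fin N)) (j k : Fin N) (hk : k ≠ j) :
    permOp π * swapQuot j k hk = swapQuot (π j) (π k) (π.injective.ne hk) * permOp π := by
  refine LinearMap.ext fun f => ?_
  have h := map_divDiff (rename π) (swapHom j k) (swapHom (π j) (π k)) (X j - X k)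
    (X (π j) - X (π k)) (X_sub_X_ne_zero hk) (X_sub_X_ne_zero (π.injective.ne hk))
    (swap_dvd _ _) (swap_dvd _ _) 1 (AlgHom.toLinearMap_injective (permOp_mul_swap π j k))
    (by simp) f
  rw [one_smul] at h
  exact h.symm

theorem permOp_mul_signSwapQuot (π : Equiv.Perm (Fin N)) (j k : Fin N) (hk : k ≠ j) :
    permOp π * signSwapQuot j k hk = signSwapQuot (π j) (π k) (π.injective.ne hk) * permOp π := by
  refine LinearMap.ext fun f => ?_
  have h0 : permOp π * (signSwapHom j k).toLinearMap
      = (signSwapHom (π j) (π k)).toLinearMap * permOp π := by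
    simp only [signSwapHom_toLinearMap, ← mul_assoc, permOp_mul_signOp]
    simp only [mul_assoc, ← permOp_mul_swap]
    simp only [← mul_assoc, permOp_mul_signOp]
  have h := map_divDiff (rename π) (signSwapHom j k) (signSwapHom (π j) (π k)) (X j + X k)
    (X (π j) + X (π k)) (X_add_X_ne_zero hk) (X_add_X_ne_zero (π.injective.ne hk))
    (signSwap_dvd hk) (signSwap_dvd (π.injective.ne hk)) 1 (AlgHom.toLinearMap_injective h0)
    (by simp) f
  rw [one_smul] at h
  exact h.symm

theorem permOp_mul_signQuot (π : Equiv.Perm (Fin N)) (j : Fin N) :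
    permOp π * signQuot j = signQuot (π j) * permOp π := by
  refine LinearMap.ext fun f => ?_
  have h := map_divDiff (rename π) (signHom j) (signHom (π j)) (X j) (X (π j))
    (MvPolynomial.X_ne_zero j) (MvPolynomial.X_ne_zero _) (sign_dvd _) (sign_dvd _) 1
    (AlgHom.toLinearMap_injective (permOp_mul_signOp π j)) (by simp) f
  rw [one_smul] at h
  exact h.symm

theorem signOp_mul_swapQuot_of_ne {i j k : Fin N} (hk : k ≠ j) (hij : i ≠ j) (hik : i ≠ k) :
    signOp i * swapQuot j k hk = swapQuot j k hk * signOp i := by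
  refine LinearMap.ext fun f => ?_
  have h := map_divDiff (signHom i) (swapHom j k) (swapHom j k) (X j - X k) (X j - X k)
    (X_sub_X_ne_zero hk) (X_sub_X_ne_zero hk) (swap_dvd _ _) (swap_dvd _ _) 1
    (AlgHom.toLinearMap_injective (signOp_commute_swap hij hik))
    (by simp [signHom_X, hij.symm, hik.symm]) f
  rw [one_smul] at h
  exact h.symm

theorem signOp_mul_signSwapQuot_of_ne {i j k : Fin N} (hk : k ≠ j) (hij : i ≠ j) (hik : i ≠ k) :
    signOp i * signSwapQuot j k hk = signSwapQuot j k hk * signOp i := by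
  refine LinearMap.ext fun f => ?_
  have h0 : signOp i * (signSwapHom j k).toLinearMap
      = (signSwapHom j k).toLinearMap * signOp i := by
    rw [signSwapHom_toLinearMap]
    exact (((signOp_comm i j).mul_right (signOp_comm i k)).mul_right
      (signOp_commute_swap hij hik)).eq
  have h := map_divDiff (signHom i) (signSwapHom j k) (signSwapHom j k) (X j + X k) (X j + X k)
    (X_add_X_ne_zero hk) (X_add_X_ne_zero hk) (signSwap_dvd hk) (signSwap_dvd hk) 1
    (AlgHom.toLinearMap_injective h0)
    (by simp [signHom_X, hij.symm, hik.symm]) f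
  rw [one_smul] at h
  exact h.symm

theorem signOp_mul_swapQuot_right {j k : Fin N} (hk : k ≠ j) :
    signOp k * swapQuot j k hk = signSwapQuot j k hk * signOp k := by
  refine LinearMap.ext fun f => ?_
  have h := map_divDiff (signHom k) (swapHom j k) (signSwapHom j k) (X j - X k) (X j + X k)
    (X_sub_X_ne_zero hk) (X_add_X_ne_zero hk) (swap_dvd _ _) (signSwap_dvd hk) 1
    (AlgHom.toLinearMap_injective (signOp_mul_swap_right j k))
    (by simp [signHom_X, hk.symm]) f
  rw [one_smul] at h
  exact h.symm

theorem signOp_mul_signSwapQuot_right {j k : Fin N} (hk : k ≠ j) :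
    signOp k * signSwapQuot j k hk = swapQuot j k hk * signOp k := by
  have h := signOp_mul_swapQuot_right hk
  have h1 := congrArg (fun T => signOp k * T * signOp k) h
  simp only [mul_assoc, signOp_mul_self, mul_one] at h1
  rw [← h1, ← mul_assoc, signOp_mul_self, one_mul]

/-- The minus sign arises because `t_j` sends `z_j - z_k` to `-(z_j + z_k)`. -/
theorem signOp_mul_swapQuot_left {j k : Fin N} (hk : k ≠ j) :
    signOp j * swapQuot j k hk = -(signSwapQuot j k hk * signOp j) := by
  refine LinearMap.ext fun f => ?_
  have h := map_divDiff (signHom j) (swapHom j k) (signSwapHom j k) (X j - X k) (X j + X k)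
    (X_sub_X_ne_zero hk) (X_add_X_ne_zero hk) (swap_dvd _ _) (signSwap_dvd hk) (-1)
    (AlgHom.toLinearMap_injective (signOp_mul_swap_left j k))
    (by simp [signHom_X, hk]; ring) f
  rw [neg_smul, one_smul] at h
  exact neg_eq_iff_eq_neg.mp h.symm

theorem signOp_mul_signSwapQuot_left {j k : Fin N} (hk : k ≠ j) :
    signOp j * signSwapQuot j k hk = -(swapQuot j k hk * signOp j) := by
  have key : ∀ {R : Type} [Ring R] (t a b : R), t * t = 1 → t * a = -(b * t) →
      t * b = -(a * t) := by
    intro R _ t a b ht h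
    calc t * b = -(t * -(b * t) * t) := by
          rw [mul_neg, neg_mul, neg_neg, mul_assoc, mul_assoc, ht, mul_one]
      _ = -(a * t) := by rw [← h, ← mul_assoc, ht, one_mul]
  exact key _ _ _ (signOp_mul_self j) (signOp_mul_swapQuot_left hk)

theorem signOp_mul_signQuot_of_ne {i j : Fin N} (h : i ≠ j) :
    signOp i * signQuot j = signQuot j * signOp i := by
  refine LinearMap.ext fun f => ?_
  have h := map_divDiff (signHom i) (signHom j) (signHom j) (X j) (X j)
    (MvPolynomial.X_ne_zero j) (MvPolynomial.X_ne_zero j) (sign_dvd _) (sign_dvd _) 1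
    (AlgHom.toLinearMap_injective (signOp_comm i j))
    (by simp [signHom_X, h.symm]) f
  rw [one_smul] at h
  exact h.symm

theorem signOp_mul_signQuot_self (j : Fin N) :
    signOp j * signQuot j = -(signQuot j * signOp j) := by
  refine LinearMap.ext fun f => ?_
  have h := map_divDiff (signHom j) (signHom j) (signHom j) (X j) (X j)
    (MvPolynomial.X_ne_zero j) (MvPolynomial.X_ne_zero j) (sign_dvd _) (sign_dvd _) (-1)
    rfl (by simp [signHom_X]) f
  rw [neg_smul, one_smul] at h
  exact neg_eq_iff_eq_neg.mp h.symm

theorem pderiv_rename_perm (π : Equiv.Perm (Fin N)) (j : Fin N) (f : Poly N) :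
    rename π (pderiv j f) = pderiv (π j) (rename π f) :=
  (pderiv_rename π.injective j f).symm

theorem pderiv_signHom (i j : Fin N) (f : Poly N) :
    signHom i (pderiv j f) = (if i = j then -1 else 1 : ℂ) • pderiv j (signHom i f) := by
  induction f using MvPolynomial.induction_on with
  | C a =>
    have : signHom i (C a : Poly N) = C a := (signHom i).commutes a
    simp [this]
  | add p q hp hq => simp only [map_add, hp, hq, smul_add]
  | mul_X p l hp =>
    simp only [Derivation.leibniz, map_add, map_mul, hp, smul_eq_mul, signHom_X, smul_add,
      mul_smul_comm]
    congr 1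
    by_cases h : l = i
    · subst h
      by_cases h' : l = j
      · subst h'; simp
      · simp [h', pderiv_X]
    · by_cases h' : l = j
      · subst h'; simp [h, Ne.symm h]
      · simp [h, h', pderiv_X]

theorem permOp_mul_dunkl (β : ℕ) (γ : ℝ) (π : Equiv.Perm (Fin N)) (j : Fin N) :
    permOp π * dunkl β γ j = dunkl β γ (π j) * permOp π := by
  have h1 : permOp π * (pderiv j : Derivation ℂ (Poly N) (Poly N)).toLinearMap
      = (pderiv (π j) : Derivation ℂ (Poly N) (Poly N)).toLinearMap * permOp π :=
    LinearMap.ext fun f => pderiv_rename_perm π j f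
  have h2 : permOp π * ∑ k : {k : Fin N // k ≠ j}, (swapQuot j k.1 k.2 + signSwapQuot j k.1 k.2)
      = (∑ k : {k : Fin N // k ≠ π j},
        (swapQuot (π j) k.1 k.2 + signSwapQuot (π j) k.1 k.2)) * permOp π := by
    rw [Finset.mul_sum, Finset.sum_mul]
    refine Fintype.sum_equiv (π.subtypeEquiv fun k => by simp) _ _ fun k => ?_
    rw [mul_add, add_mul, permOp_mul_swapQuot, permOp_mul_signSwapQuot]
    rfl
  rw [dunkl, dunkl, mul_add, mul_add, add_mul, add_mul, h1, mul_smul_comm, mul_smul_comm,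
    smul_mul_assoc, smul_mul_assoc, h2, permOp_mul_signQuot]

theorem signOp_mul_dunkl_of_ne (β : ℕ) (γ : ℝ) {i j : Fin N} (h : i ≠ j) :
    signOp i * dunkl β γ j = dunkl β γ j * signOp i := by
  have h1 : signOp i * (pderiv j : Derivation ℂ (Poly N) (Poly N)).toLinearMap
      = (pderiv j : Derivation ℂ (Poly N) (Poly N)).toLinearMap * signOp i := by
    refine LinearMap.ext fun f => ?_
    have := pderiv_signHom i j f
    rwa [if_neg h, one_smul] at this
  have h2 : signOp i * ∑ k : {k : Fin N // k ≠ j}, (swapQuot j k.1 k.2 + signSwapQuot j k.1 k.2)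
      = (∑ k : {k : Fin N // k ≠ j}, (swapQuot j k.1 k.2 + signSwapQuot j k.1 k.2)) * signOp i := by
    rw [Finset.mul_sum, Finset.sum_mul]
    refine Finset.sum_congr rfl fun k _ => ?_
    rw [mul_add, add_mul]
    by_cases hk : i = k.1
    · obtain ⟨k, hk'⟩ := k
      subst hk
      rw [signOp_mul_swapQuot_right, signOp_mul_signSwapQuot_right, add_comm]
    · rw [signOp_mul_swapQuot_of_ne _ h hk, signOp_mul_signSwapQuot_of_ne _ h hk]
  rw [dunkl, mul_add, mul_add, add_mul, add_mul, h1, mul_smul_comm, mul_smul_comm,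
    smul_mul_assoc, smul_mul_assoc, h2, signOp_mul_signQuot_of_ne h]

theorem signOp_mul_dunkl_self (β : ℕ) (γ : ℝ) (j : Fin N) :
    signOp j * dunkl β γ j = -(dunkl β γ j * signOp j) := by
  have h1 : signOp j * (pderiv j : Derivation ℂ (Poly N) (Poly N)).toLinearMap
      = -((pderiv j : Derivation ℂ (Poly N) (Poly N)).toLinearMap * signOp j) := by
    refine LinearMap.ext fun f => ?_
    have := pderiv_signHom j j f
    rwa [if_pos rfl, neg_smul, one_smul] at this
  have h2 : signOp j * ∑ k : {k : Fin N // k ≠ j}, (swapQuot j k.1 k.2 + signSwapQuot j k.1 k.2)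
      = -((∑ k : {k : Fin N // k ≠ j}, (swapQuot j k.1 k.2 + signSwapQuot j k.1 k.2))
        * signOp j) := by
    rw [Finset.mul_sum, Finset.sum_mul, ← Finset.sum_neg_distrib]
    refine Finset.sum_congr rfl fun k _ => ?_
    rw [mul_add, add_mul, signOp_mul_swapQuot_left, signOp_mul_signSwapQuot_left, neg_add_rev]
  rw [dunkl, mul_add, mul_add, add_mul, add_mul, h1, mul_smul_comm, mul_smul_comm,
    smul_mul_assoc, smul_mul_assoc, h2, signOp_mul_signQuot_self, smul_neg, smul_neg, neg_add,
    neg_add]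

/-! ### Commutators of Dunkl operators with the variables. -/

theorem swapQuot_X (j k l : Fin N) (hk : k ≠ j) :
    swapQuot j k hk (X l) = if l = j then 1 else if l = k then -1 else 0 := by
  apply divDiff_eq_of_mul_eq
  rw [swapHom_X, Equiv.swap_apply_def]
  split_ifs with h h'
  · rw [h, mul_one]
  · rw [h']; ring
  · simp

theorem signSwapQuot_X (j k l : Fin N) (hk : k ≠ j) :
    signSwapQuot j k hk (X l) = if l = j then 1 else if l = k then 1 else 0 := by
  apply divDiff_eq_of_mul_eq
  rw [signSwapHom_X, Equiv.swap_apply_def]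
  split_ifs with h h'
  · simp [signHom_X, h, hk]
  · simp [signHom_X, h', hk.symm, add_comm]
  · simp [signHom_X, h, h']

theorem signQuot_X (j l : Fin N) :
    signQuot j (X l : Poly N) = if l = j then 2 else 0 := by
  apply divDiff_eq_of_mul_eq
  rw [signHom_X]
  split_ifs with h
  · rw [h]; ring
  · simp

theorem swapQuot_mul (j k : Fin N) (hk : k ≠ j) (p q : Poly N) :
    swapQuot j k hk (p * q) = p * swapQuot j k hk q + swapQuot j k hk p * swapHom j k q :=
  divDiff_mul _ _ _ _ _ _

theorem signSwapQuot_mul (j k : Fin N) (hk : k ≠ j) (p q : Poly N) :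
    signSwapQuot j k hk (p * q)
      = p * signSwapQuot j k hk q + signSwapQuot j k hk p * signSwapHom j k q :=
  divDiff_mul _ _ _ _ _ _

theorem signQuot_mul (j : Fin N) (p q : Poly N) :
    signQuot j (p * q) = p * signQuot j q + signQuot j p * signHom j q :=
  divDiff_mul _ _ _ _ _ _

theorem mulOp_apply (p q : Poly N) : mulOp p q = p * q := rfl

theorem swapQuot_mulOp (j k l : Fin N) (hk : k ≠ j) :
    swapQuot j k hk * mulOp (X l) = mulOp (X l) * swapQuot j k hk
      + (if l = j then 1 else if l = k then -1 else 0 : ℂ) • permOp (Equiv.swap j k) := by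
  refine LinearMap.ext fun f => ?_
  simp only [Module.End.mul_apply, mulOp_apply, LinearMap.add_apply, LinearMap.smul_apply,
    swapQuot_mul, swapQuot_X, ← swapHom_toLinearMap, AlgHom.toLinearMap_apply]
  split_ifs <;> simp

theorem signSwapQuot_mulOp (j k l : Fin N) (hk : k ≠ j) :
    signSwapQuot j k hk * mulOp (X l) = mulOp (X l) * signSwapQuot j k hk
      + (if l = j then 1 else if l = k then 1 else 0 : ℂ) •
        (signOp j * signOp k * permOp (Equiv.swap j k)) := by
  refine LinearMap.ext fun f => ?_
  rw [← signSwapHom_toLinearMap]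
  simp only [Module.End.mul_apply, mulOp_apply, LinearMap.add_apply, LinearMap.smul_apply,
    signSwapQuot_mul, signSwapQuot_X, AlgHom.toLinearMap_apply]
  split_ifs <;> simp

theorem signQuot_mulOp (j l : Fin N) :
    signQuot j * mulOp (X l) = mulOp (X l) * signQuot j
      + (if l = j then 2 else 0 : ℂ) • signOp j := by
  refine LinearMap.ext fun f => ?_
  simp only [Module.End.mul_apply, mulOp_apply, LinearMap.add_apply, LinearMap.smul_apply,
    signQuot_mul, signQuot_X, signOp, AlgHom.toLinearMap_apply]
  split_ifs
  · rw [two_smul, two_mul]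
  · simp

theorem pderiv_mulOp (j l : Fin N) :
    (pderiv j : Derivation ℂ (Poly N) (Poly N)).toLinearMap * mulOp (X l)
      = mulOp (X l) * (pderiv j : Derivation ℂ (Poly N) (Poly N)).toLinearMap
        + (if l = j then 1 else 0 : ℂ) • 1 := by
  refine LinearMap.ext fun f => ?_
  have h : pderiv j (X l * f) = X l * pderiv j f + (if l = j then 1 else 0 : ℂ) • f := by
    rw [Derivation.leibniz, pderiv_X, Pi.single_apply]
    split_ifs <;> simp_all
  exact h

/-- `[D_j, z_l]` for `l ≠ j`. -/
theorem dunkl_mulOp_of_ne (β : ℕ) (γ : ℝ) {j l : Fin N} (h : l ≠ j) :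
    dunkl β γ j * mulOp (X l) = mulOp (X l) * dunkl β γ j + (β : ℂ) •
      (signOp j * signOp l * permOp (Equiv.swap j l) - permOp (Equiv.swap j l)) := by
  have h1 := pderiv_mulOp j l
  have h3 := signQuot_mulOp j l
  rw [if_neg h, zero_smul, add_zero] at h1 h3
  have h2 : (∑ k : {k : Fin N // k ≠ j}, (swapQuot j k.1 k.2 + signSwapQuot j k.1 k.2))
      * mulOp (X l) = mulOp (X l) * (∑ k : {k : Fin N // k ≠ j},
        (swapQuot j k.1 k.2 + signSwapQuot j k.1 k.2)) +
      (signOp j * signOp l * permOp (Equiv.swap j l) - permOp (Equiv.swap j l)) := by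
    rw [Finset.sum_mul, Finset.mul_sum, ← sub_eq_iff_eq_add', ← Finset.sum_sub_distrib,
      Finset.sum_eq_single ⟨l, h⟩]
    · rw [add_mul, mul_add, swapQuot_mulOp, signSwapQuot_mulOp]
      simp only [if_neg h, if_true]
      module
    · intro k _ hk
      have hk' : l ≠ k.1 := fun h' => hk (Subtype.ext h'.symm)
      rw [add_mul, mul_add, swapQuot_mulOp, signSwapQuot_mulOp]
      simp only [if_neg h, if_neg hk']
      module
    · simp
  rw [dunkl, add_mul, add_mul, mul_add, mul_add, h1, mul_smul_comm, mul_smul_comm,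
    smul_mul_assoc, smul_mul_assoc, h2, h3]
  module

/-- `[D_j, z_j]`. -/
theorem dunkl_mulOp_self (β : ℕ) (γ : ℝ) (j : Fin N) :
    dunkl β γ j * mulOp (X j) = mulOp (X j) * dunkl β γ j + (1 + (β : ℂ) •
      (∑ k : {k : Fin N // k ≠ j}, pairOp j k.1) + (2 * γ : ℂ) • signOp j) := by
  have h1 := pderiv_mulOp j j
  have h3 := signQuot_mulOp j j
  rw [if_pos rfl] at h1 h3
  have h2 : (∑ k : {k : Fin N // k ≠ j}, (swapQuot j k.1 k.2 + signSwapQuot j k.1 k.2))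
      * mulOp (X j) = mulOp (X j) * (∑ k : {k : Fin N // k ≠ j},
        (swapQuot j k.1 k.2 + signSwapQuot j k.1 k.2)) + ∑ k : {k : Fin N // k ≠ j}, pairOp j k.1 := by
    rw [Finset.sum_mul, Finset.mul_sum, ← Finset.sum_add_distrib]
    refine Finset.sum_congr rfl fun k _ => ?_
    rw [add_mul, mul_add, swapQuot_mulOp, signSwapQuot_mulOp, pairOp_eq, add_mul]
    simp only [if_true, one_mul]
    module
  rw [dunkl, add_mul, add_mul, mul_add, mul_add, h1, mul_smul_comm, mul_smul_comm,
    smul_mul_assoc, smul_mul_assoc, h2, h3]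
  module

/-! ### Commutativity of the Dunkl operators. -/

theorem signSwap_symm (j k : Fin N) :
    signOp j * signOp k * permOp (Equiv.swap j k)
      = signOp k * signOp j * permOp (Equiv.swap k j) := by
  rw [(signOp_comm j k).eq, Equiv.swap_comm]

theorem permOp_swap_commute_dunkl (β : ℕ) (γ : ℝ) {i j k : Fin N} (hj : i ≠ j) (hk : i ≠ k) :
    Commute (dunkl β γ i) (permOp (Equiv.swap j k)) := by
  have h := permOp_mul_dunkl β γ (Equiv.swap j k) i
  rw [Equiv.swap_apply_of_ne_of_ne hj hk] at h
  exact h.symm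

theorem signOp_commute_dunkl (β : ℕ) (γ : ℝ) {i j : Fin N} (h : i ≠ j) :
    Commute (dunkl β γ i) (signOp j) := (signOp_mul_dunkl_of_ne β γ h.symm).symm

theorem signSwap_commute_dunkl (β : ℕ) (γ : ℝ) {i j k : Fin N} (hj : i ≠ j) (hk : i ≠ k) :
    Commute (dunkl β γ i) (signOp j * signOp k * permOp (Equiv.swap j k)) :=
  ((signOp_commute_dunkl β γ hj).mul_right (signOp_commute_dunkl β γ hk)).mul_right
    (permOp_swap_commute_dunkl β γ hj hk)

theorem pairOp_commute_dunkl (β : ℕ) (γ : ℝ) {i j k : Fin N} (hj : i ≠ j) (hk : i ≠ k) :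
    Commute (dunkl β γ i) (pairOp j k) := by
  have h : pairOp j k
      = permOp (Equiv.swap j k) + signOp j * signOp k * permOp (Equiv.swap j k) := by
    rw [pairOp_eq, add_mul, one_mul]
  rw [h]
  exact (permOp_swap_commute_dunkl β γ hj hk).add_right (signSwap_commute_dunkl β γ hj hk)

theorem signOp_mul_signOp_mul_dunkl_left (β : ℕ) (γ : ℝ) {i j : Fin N} (h : i ≠ j) :
    signOp i * signOp j * dunkl β γ i = -(dunkl β γ i * (signOp i * signOp j)) := by
  have key : ∀ {R : Type} [Ring R] (s t a : R), s * a = -(a * s) → t * a = a * t →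
      s * t * a = -(a * (s * t)) := by
    intro R _ s t a h1 h2
    rw [mul_assoc, h2, ← mul_assoc, h1, neg_mul, mul_assoc]
  exact key _ _ _ (signOp_mul_dunkl_self β γ i) (signOp_mul_dunkl_of_ne β γ h.symm)

theorem signOp_mul_signOp_mul_dunkl_right (β : ℕ) (γ : ℝ) {i j : Fin N} (h : i ≠ j) :
    signOp i * signOp j * dunkl β γ j = -(dunkl β γ j * (signOp i * signOp j)) := by
  rw [(signOp_comm i j).eq]
  exact signOp_mul_signOp_mul_dunkl_left β γ h.symm

theorem dunkl_apply_one (β : ℕ) (γ : ℝ) (j : Fin N) : dunkl β γ j 1 = 0 := by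
  have h1 : ∀ (k : Fin N) (hk : k ≠ j), swapQuot j k hk 1 = 0 := fun k hk =>
    divDiff_eq_of_mul_eq _ _ (by simp)
  have h2 : ∀ (k : Fin N) (hk : k ≠ j), signSwapQuot j k hk 1 = 0 := fun k hk =>
    divDiff_eq_of_mul_eq _ _ (by simp)
  have h3 : signQuot j (1 : Poly N) = 0 := divDiff_eq_of_mul_eq _ _ (by simp)
  simp [dunkl, h1, h2, h3]

/-- Such a `T` satisfies `T f = f · T 1`. Applied to `[D_i, D_j]`, this reduces commutativity to
commutators with single variables. -/
theorem end_eq_zero_of_commute_mulOp (T : Module.End ℂ (Poly N)) (h1 : T 1 = 0)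
    (h : ∀ l, T * mulOp (X l) = mulOp (X l) * T) : T = 0 := by
  refine LinearMap.ext fun f => ?_
  induction f using MvPolynomial.induction_on with
  | C a => rw [← mul_one (C a), ← smul_eq_C_mul, map_smul, h1]; simp
  | add p q hp hq => rw [map_add, hp, hq]; simp
  | mul_X p l hp =>
    have h2 : T (X l * p) = X l * T p := LinearMap.congr_fun (h l) p
    rw [mul_comm, h2, hp]; simp

/-- Jacobi identity: `[[A, B], x] = [A, b] - [B, a]` when `a = [A, x]` and `b = [B, x]`. -/
theorem commutator_mul_eq {R : Type*} [Ring R] {A B x a b : R} (hA : A * x = x * A + a)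
    (hB : B * x = x * B + b) (h : A * b - b * A = B * a - a * B) :
    (A * B - B * A) * x = x * (A * B - B * A) := by
  have h1 : A * B * x = x * (A * B) + (a * B + A * b) := by
    rw [mul_assoc, hB, mul_add, ← mul_assoc, hA, add_mul, mul_assoc, add_assoc]
  have h2 : B * A * x = x * (B * A) + (b * A + B * a) := by
    rw [mul_assoc, hA, mul_add, ← mul_assoc, hB, add_mul, mul_assoc, add_assoc]
  rw [sub_mul, h1, h2, mul_sub]
  have h3 : a * B + A * b = b * A + B * a := by
    rw [sub_eq_sub_iff_add_eq_add] at h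
    rw [add_comm (a * B), h, add_comm]
  rw [h3]; abel

theorem dunkl_commute_aux {R : Type*} [Ring R] {A B s τ : R} (h1 : s * A = B * s)
    (h2 : s * B = A * s) (h3 : τ * A = -(A * τ)) (h4 : τ * B = -(B * τ)) :
    A * (τ * s - s) - (τ * s - s) * A = B * (s + τ * s) - (s + τ * s) * B := by
  have h5 : τ * s * A = -(B * (τ * s)) := by rw [mul_assoc, h1, ← mul_assoc, h4, neg_mul, mul_assoc]
  have h6 : τ * s * B = -(A * (τ * s)) := by rw [mul_assoc, h2, ← mul_assoc, h3, neg_mul, mul_assoc]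
  rw [sub_mul, add_mul, h5, h6, h1, h2, mul_sub, mul_add]
  abel

theorem commutator_smul (c : ℂ) (A b : Module.End ℂ (Poly N)) :
    A * (c • b) - (c • b) * A = c • (A * b - b * A) := by
  rw [mul_smul_comm, smul_mul_assoc, smul_sub]

/-- The commutator `[D_i, D_j]` commutes with `z_i`. -/
theorem dunkl_commutator_X_left (β : ℕ) (γ : ℝ) {i j : Fin N} (h : i ≠ j) :
    (dunkl β γ i * dunkl β γ j - dunkl β γ j * dunkl β γ i) * mulOp (X i)
      = mulOp (X i) * (dunkl β γ i * dunkl β γ j - dunkl β γ j * dunkl β γ i) := by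
  refine commutator_mul_eq (dunkl_mulOp_self β γ i) (dunkl_mulOp_of_ne β γ h) ?_
  rw [commutator_smul, signSwap_symm j i, Equiv.swap_comm j i]
  have hs1 := permOp_mul_dunkl β γ (Equiv.swap i j) i
  have hs2 := permOp_mul_dunkl β γ (Equiv.swap i j) j
  rw [Equiv.swap_apply_left] at hs1
  rw [Equiv.swap_apply_right] at hs2
  refine (congrArg ((β : ℂ) • ·) (dunkl_commute_aux hs1 hs2
    (signOp_mul_signOp_mul_dunkl_left β γ h) (signOp_mul_signOp_mul_dunkl_right β γ h))).trans
    ((commutator_smul _ _ _).symm.trans ?_)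
  have hsum : ∑ k : {k : Fin N // k ≠ i}, pairOp i k.1
      = pairOp i j + ∑ k ∈ Finset.univ.erase (⟨j, h.symm⟩ : {k : Fin N // k ≠ i}), pairOp i k.1 := by
    rw [← Finset.add_sum_erase Finset.univ (fun k : {k : Fin N // k ≠ i} => pairOp i k.1)
      (Finset.mem_univ ⟨j, h.symm⟩)]
  -- Apart from the pair operator of `i` and `j`, the terms of `[D_i, z_i]` leave `z_j` alone and so
  -- commute with `D_j`.
  have hc : Commute (dunkl β γ j) (1 + (β : ℂ) • ∑ k ∈ Finset.univ.erase
      (⟨j, h.symm⟩ : {k : Fin N // k ≠ i}), pairOp i k.1 + (2 * γ : ℂ) • signOp i) := by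
    refine ((Commute.one_right _).add_right (Commute.smul_right (Commute.sum_right _ _ _
      fun k hk => ?_) _)).add_right (Commute.smul_right (signOp_commute_dunkl β γ h.symm) _)
    refine pairOp_commute_dunkl β γ h.symm fun hjk => ?_
    exact (Finset.mem_erase.mp hk).1 (Subtype.ext hjk.symm)
  have key : ∀ {R : Type} [Ring R] (B p q r : R), r = p + q → Commute B q →
      B * p - p * B = B * r - r * B := by
    intro R _ B p q r hr hq
    rw [hr, mul_add, add_mul, hq.eq]; abel
  refine key _ _ _ _ ?_ hc
  rw [hsum, pairOp_eq, add_mul, one_mul]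
  module

/-- The Dunkl operators commute. -/
theorem dunkl_commute (β : ℕ) (γ : ℝ) (i j : Fin N) : Commute (dunkl β γ i) (dunkl β γ j) := by
  by_cases h : i = j
  · rw [h]
  refine sub_eq_zero.mp (end_eq_zero_of_commute_mulOp _ ?_ fun l => ?_)
  · simp [dunkl_apply_one]
  by_cases hi : l = i
  · subst hi; exact dunkl_commutator_X_left β γ h
  by_cases hj : l = j
  · subst hj
    have key : ∀ {R : Type} [Ring R] (a b x : R), (a * b - b * a) * x = x * (a * b - b * a) →
        (b * a - a * b) * x = x * (b * a - a * b) := by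
      intro R _ a b x hx
      rw [← neg_sub (a * b), neg_mul, hx, mul_neg]
    exact key _ _ _ (dunkl_commutator_X_left β γ (Ne.symm h))
  -- For a third variable `z_l`, `[D_i, z_l]` involves only the indices `i, l` and commutes with
  -- `D_j`; likewise with `i` and `j` exchanged.
  refine commutator_mul_eq (dunkl_mulOp_of_ne β γ hi) (dunkl_mulOp_of_ne β γ hj) ?_
  rw [commutator_smul, commutator_smul]
  have h1 := (signSwap_commute_dunkl β γ h (Ne.symm hi)).sub_right
    (permOp_swap_commute_dunkl β γ h (Ne.symm hi))
  have h2 := (signSwap_commute_dunkl β γ (Ne.symm h) (Ne.symm hj)).sub_right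
    (permOp_swap_commute_dunkl β γ (Ne.symm h) (Ne.symm hj))
  rw [sub_eq_zero.mpr h1.eq, sub_eq_zero.mpr h2.eq]

/-! ### The oscillator operators and their commutators. -/

theorem permOp_mul_mulOp (π : Equiv.Perm (Fin N)) (p : Poly N) :
    permOp π * mulOp p = mulOp (rename π p) * permOp π :=
  LinearMap.ext fun f => map_mul (rename π) p f

theorem signOp_mul_mulOp (j : Fin N) (p : Poly N) :
    signOp j * mulOp p = mulOp (signHom j p) * signOp j :=
  LinearMap.ext fun f => map_mul (signHom j) p f

theorem mulOp_commute (p q : Poly N) : Commute (mulOp p) (mulOp q) :=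
  LinearMap.ext fun f => mul_left_comm p q f

/-- The operator `2 z_j - D_j`. -/
noncomputable def raiseOp (β : ℕ) (γ : ℝ) (j : Fin N) : Module.End ℂ (Poly N) :=
  mulOp (2 * X j) - dunkl β γ j

/-- The operator `b†_j b_j`. -/
noncomputable def oscOp (β : ℕ) (γ : ℝ) (j : Fin N) : Module.End ℂ (Poly N) :=
  bDag β γ j * bAnn β γ j

theorem inv_sqrt_two_mul_self : ((√2 : ℝ) : ℂ)⁻¹ * ((√2 : ℝ) : ℂ)⁻¹ = 1 / 2 := by
  rw [← mul_inv, ← Complex.ofReal_mul, Real.mul_self_sqrt (by norm_num)]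
  norm_num

theorem oscOp_eq (β : ℕ) (γ : ℝ) (j : Fin N) :
    oscOp β γ j = (1 / 2 : ℂ) • (raiseOp β γ j * dunkl β γ j) := by
  rw [oscOp, bDag, bAnn, smul_mul_assoc, mul_smul_comm, smul_smul, inv_sqrt_two_mul_self]
  rfl

theorem permOp_mul_raiseOp (β : ℕ) (γ : ℝ) (π : Equiv.Perm (Fin N)) (j : Fin N) :
    permOp π * raiseOp β γ j = raiseOp β γ (π j) * permOp π := by
  have h : rename π (2 * X j : Poly N) = 2 * X (π j) := by
    rw [map_mul, rename_X]; congr 1; exact map_ofNat _ 2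
  rw [raiseOp, raiseOp, mul_sub, sub_mul, permOp_mul_mulOp, permOp_mul_dunkl, h]

/-- For `i = j` both factors anticommute with `t_j`, so the two signs cancel; for `i ≠ j` both
commute with `t_i`. -/
theorem signOp_commute_raiseOp_mul_dunkl (β : ℕ) (γ : ℝ) (i j : Fin N) :
    Commute (signOp i) (raiseOp β γ j * dunkl β γ j) := by
  have key : ∀ {R : Type} [Ring R] (t x x' a : R), t * x = x' * t → x' = -x → t * a = -(a * t) →
      t * ((x - a) * a) = ((x - a) * a) * t := by
    intro R _ t x x' a h1 h2 h3
    rw [← mul_assoc, mul_sub, h1, h2, h3, neg_mul, sub_neg_eq_add, add_mul, neg_mul, mul_assoc,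
      mul_assoc a, h3, mul_neg, mul_neg, sub_mul, sub_mul, mul_assoc, mul_assoc]
    abel
  by_cases h : i = j
  · subst h
    refine key _ _ _ _ (signOp_mul_mulOp _ _) ?_ (signOp_mul_dunkl_self β γ i)
    have h2 : signHom i (2 * X i : Poly N) = -(2 * X i) := by
      rw [map_mul, signHom_X, if_pos rfl, mul_neg]; congr 2; exact map_ofNat _ 2
    rw [h2]
    exact LinearMap.ext fun f => neg_mul _ _
  · refine Commute.mul_right (Commute.sub_right ?_ (signOp_mul_dunkl_of_ne β γ h))
      (signOp_mul_dunkl_of_ne β γ h)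
    have h2 : signHom i (2 * X j : Poly N) = 2 * X j := by
      rw [map_mul, signHom_X, if_neg (Ne.symm h)]; congr 1; exact map_ofNat _ 2
    rw [Commute, SemiconjBy, signOp_mul_mulOp, h2]

theorem permOp_mul_oscOp (β : ℕ) (γ : ℝ) (π : Equiv.Perm (Fin N)) (j : Fin N) :
    permOp π * oscOp β γ j = oscOp β γ (π j) * permOp π := by
  rw [oscOp_eq, oscOp_eq, mul_smul_comm, smul_mul_assoc, ← mul_assoc, permOp_mul_raiseOp,
    mul_assoc, permOp_mul_dunkl, ← mul_assoc]

theorem signOp_commute_oscOp (β : ℕ) (γ : ℝ) (i j : Fin N) :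
    Commute (signOp i) (oscOp β γ j) := by
  rw [oscOp_eq]
  exact (signOp_commute_raiseOp_mul_dunkl β γ i j).smul_right _

theorem pairOp_commute_oscOp (β : ℕ) (γ : ℝ) {i j k : Fin N} (hj : i ≠ j) (hk : i ≠ k) :
    Commute (pairOp j k) (oscOp β γ i) := by
  have h := permOp_mul_oscOp β γ (Equiv.swap j k) i
  rw [Equiv.swap_apply_of_ne_of_ne hj hk] at h
  rw [pairOp_eq]
  exact ((Commute.one_left _).add_left ((signOp_commute_oscOp β γ j i).mul_left
    (signOp_commute_oscOp β γ k i))).mul_left h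

theorem pairOp_mul_oscOp (β : ℕ) (γ : ℝ) (i j : Fin N) :
    pairOp i j * oscOp β γ i = oscOp β γ j * pairOp i j := by
  rw [pairOp_eq, mul_assoc, permOp_mul_oscOp, Equiv.swap_apply_left, ← mul_assoc,
    (((Commute.one_left _).add_left ((signOp_commute_oscOp β γ i j).mul_left
    (signOp_commute_oscOp β γ j j)))).eq, mul_assoc]

/-- Here `A, B` are two Dunkl operators, `U, V` the raising operators and `r` the cross commutator
`[D_i, z_j]`. Moving `r` past a Dunkl operator turns it into the pair operator `P`, leaving a
failure of commutativity that the Jucys–Murphy sums in `h_j` will compensate. -/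
theorem raise_lower_commutator {R : Type*} [Ring R] {U V A B r P : R} (hAB : A * B = B * A)
    (hUV : U * V = V * U) (hA : A * V = V * A + 2 * r) (hB : B * U = U * B + 2 * r)
    (hrB : r * B = -(A * P)) (hrA : r * A = -(B * P)) :
    U * A * (V * B) - V * B * (U * A) = 2 * ((V * B - U * A) * P) := by
  have h1 : U * A * (V * B) = U * V * (A * B) - 2 * (U * A * P) := by
    calc U * A * (V * B) = U * (A * V) * B := by noncomm_ring
      _ = U * V * (A * B) + 2 * (U * (r * B)) := by rw [hA]; noncomm_ring
      _ = _ := by rw [hrB]; noncomm_ring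
  have h2 : V * B * (U * A) = U * V * (A * B) - 2 * (V * B * P) := by
    calc V * B * (U * A) = V * (B * U) * A := by noncomm_ring
      _ = V * U * (B * A) + 2 * (V * (r * A)) := by rw [hB]; noncomm_ring
      _ = _ := by rw [hrA, ← hUV, ← hAB]; noncomm_ring
  rw [h1, h2]
  noncomm_ring

theorem oscOp_commutator_aux {R : Type*} [Ring R] [Algebra ℂ R] {U V A B r P : R} (b : ℂ)
    (hAB : A * B = B * A)
    (hUV : U * V = V * U) (hA : A * V = V * A + 2 * b • r) (hB : B * U = U * B + 2 * b • r)
    (hrB : r * B = -(A * P)) (hrA : r * A = -(B * P)) :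
    ((1 / 2 : ℂ) • (U * A)) * ((1 / 2 : ℂ) • (V * B))
      - ((1 / 2 : ℂ) • (V * B)) * ((1 / 2 : ℂ) • (U * A))
      = ((1 / 2 : ℂ) • (V * B) - (1 / 2 : ℂ) • (U * A)) * (b • P) := by
  have h := raise_lower_commutator (P := b • P) hAB hUV hA hB
    (by rw [smul_mul_assoc, hrB, mul_smul_comm, smul_neg])
    (by rw [smul_mul_assoc, hrA, mul_smul_comm, smul_neg])
  simp only [smul_mul_assoc, mul_smul_comm, ← smul_sub] at h ⊢
  rw [h, two_mul]
  module

theorem raiseOp_commute_aux {R : Type*} [Ring R] {x y A B r : R} (hxy : x * y = y * x)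
    (hAB : A * B = B * A) (hA : A * y = y * A + r) (hB : B * x = x * B + r) :
    (x - A) * (y - B) = (y - B) * (x - A) := by
  rw [sub_mul, mul_sub, mul_sub, sub_mul, mul_sub, mul_sub, hxy, hAB, hA, hB]
  abel

theorem dunkl_mulOp_two_X (β : ℕ) (γ : ℝ) {i j : Fin N} (h : i ≠ j) :
    dunkl β γ i * mulOp (2 * X j) = mulOp (2 * X j) * dunkl β γ i + 2 * (β : ℂ) •
      (signOp i * signOp j * permOp (Equiv.swap i j) - permOp (Equiv.swap i j)) := by
  have key : ∀ {R : Type} [Ring R] (a x y r : R), y = x + x → a * x = x * a + r →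
      a * y = y * a + 2 * r := by
    intro R _ a x y r hy hx
    rw [hy, mul_add, hx, two_mul, add_mul]; abel
  refine key _ _ _ _ ?_ (dunkl_mulOp_of_ne β γ (Ne.symm h))
  refine LinearMap.ext fun f => ?_
  rw [LinearMap.add_apply, mulOp_apply, mulOp_apply]; ring

theorem dunkl_mulOp_two_X_symm (β : ℕ) (γ : ℝ) {i j : Fin N} (h : i ≠ j) :
    dunkl β γ j * mulOp (2 * X i) = mulOp (2 * X i) * dunkl β γ j + 2 * (β : ℂ) •
      (signOp i * signOp j * permOp (Equiv.swap i j) - permOp (Equiv.swap i j)) := by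
  rw [dunkl_mulOp_two_X β γ h.symm, signSwap_symm, Equiv.swap_comm]

theorem oscOp_commutator (β : ℕ) (γ : ℝ) {i j : Fin N} (h : i ≠ j) :
    oscOp β γ i * oscOp β γ j - oscOp β γ j * oscOp β γ i
      = (oscOp β γ j - oscOp β γ i) * ((β : ℂ) • pairOp i j) := by
  have key : ∀ {R : Type} [Ring R] (a a' b b' x r : R), a = x - a' → b = b' →
      a' * b = b * a' → (x * b = b * x + r) → a * b = b * a + r := by
    intro R _ a a' b b' x r h1 h2 h3 h4
    rw [h1, sub_mul, mul_sub, h3, h4]; abel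
  have hAB := (dunkl_commute β γ i j).eq
  have h1 := dunkl_mulOp_two_X β γ h
  have h2 := dunkl_mulOp_two_X_symm β γ h
  have hs1 := permOp_mul_dunkl β γ (Equiv.swap i j) i
  have hs2 := permOp_mul_dunkl β γ (Equiv.swap i j) j
  rw [Equiv.swap_apply_left] at hs1
  rw [Equiv.swap_apply_right] at hs2
  have ht1 := signOp_mul_signOp_mul_dunkl_left β γ h
  have ht2 := signOp_mul_signOp_mul_dunkl_right β γ h
  have key2 : ∀ {R : Type} [Ring R] (A B s t : R), s * B = A * s → t * A = -(A * t) →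
      (t * s - s) * B = -(A * ((1 + t) * s)) := by
    intro R _ A B s t h1 h2
    rw [sub_mul, h1, mul_assoc, h1, ← mul_assoc, h2]; noncomm_ring
  have key3 : ∀ {R : Type} [Ring R] (A B y r : R), A * B = B * A → A * y = y * A + r →
      A * (y - B) = (y - B) * A + r := by
    intro R _ A B y r h1 h2
    rw [mul_sub, sub_mul, h1, h2]; abel
  rw [oscOp_eq, oscOp_eq]
  refine oscOp_commutator_aux (β : ℂ) hAB
    (raiseOp_commute_aux (mulOp_commute _ _).eq hAB h1 h2) (key3 _ _ _ _ hAB h1)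
    (key3 _ _ _ _ hAB.symm h2) ?_ ?_
  · rw [pairOp_eq]; exact key2 _ _ _ _ hs2 ht1
  · rw [pairOp_eq]; exact key2 _ _ _ _ hs1 ht2

/-! ### Commutativity of the `h_j`. -/

/-- The sum `∑_{k < j} (s_{jk} + t_j t_k s_{jk})`. -/
noncomputable def jucysOp (j : Fin N) : Module.End ℂ (Poly N) :=
  ∑ k ∈ Finset.univ.filter (fun k : Fin N => k < j), pairOp j k

theorem hB_eq (β : ℕ) (γ : ℝ) (j : Fin N) :
    hB β γ j = oscOp β γ j + (β : ℂ) • jucysOp j := rfl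

theorem signOp_commute_jucysOp (i j : Fin N) : Commute (signOp i) (jucysOp j) :=
  Commute.sum_right _ _ _ fun _ _ => signOp_commute_pairOp _ _ _

theorem permOp_mul_jucysOp (π : Equiv.Perm (Fin N)) (j : Fin N) :
    permOp π * jucysOp j
      = (∑ k ∈ Finset.univ.filter (fun k : Fin N => k < j), pairOp (π j) (π k)) * permOp π := by
  rw [jucysOp, Finset.mul_sum, Finset.sum_mul]
  exact Finset.sum_congr rfl fun k _ => permOp_mul_pairOp π j k

/-- A permutation that fixes `j` and preserves the indices below `j` only permutes the summands. -/
theorem permOp_commute_jucysOp {π : Equiv.Perm (Fin N)} {j : Fin N} (hj : π j = j)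
    (h : ∀ k, k < j ↔ π k < j) : Commute (permOp π) (jucysOp j) := by
  have h1 : ∑ k ∈ Finset.univ.filter (fun k : Fin N => k < j), pairOp (π j) (π k)
      = jucysOp j := by
    rw [hj]
    exact Finset.sum_equiv π (fun k => by simpa using h k) fun _ _ => rfl
  have h2 := permOp_mul_jucysOp π j
  rw [h1] at h2
  exact h2

theorem pairOp_commute_jucysOp {i j k : Fin N} (hi : i < j) (hk : k < j) :
    Commute (pairOp i k) (jucysOp j) := by
  rw [pairOp_eq]
  refine ((Commute.one_left _).add_left ((signOp_commute_jucysOp i j).mul_left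
    (signOp_commute_jucysOp k j))).mul_left (permOp_commute_jucysOp
      (Equiv.swap_apply_of_ne_of_ne hi.ne' hk.ne') fun l => ?_)
  rw [Equiv.swap_apply_def]
  split_ifs with h1 h2
  · subst h1; simp [hi, hk]
  · subst h2; simp [hi, hk]
  · rfl

/-- The only surviving cross term is `[H, P] = (H - H') P`, because `P` intertwines `H` and `H'`; it
cancels `[H, H']`. -/
theorem hB_commute_aux {R : Type*} [Ring R] {H H' J J' P Q : R}
    (h1 : H * H' - H' * H = (H' - H) * P) (h2 : J * H' = H' * J) (hJ : J' = P + Q)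
    (hQ : Q * H = H * Q) (hP : P * H = H' * P) (hJJ : J * J' = J' * J) :
    (H + J) * (H' + J') = (H' + J') * (H + J) := by
  rw [← sub_eq_zero]
  calc (H + J) * (H' + J') - (H' + J') * (H + J)
      = (H * H' - H' * H) + (J * H' - H' * J) + (H * J' - J' * H) + (J * J' - J' * J) := by
        noncomm_ring
    _ = 0 := by
        rw [h1, h2, hJJ, hJ, mul_add, add_mul, hP, hQ]; noncomm_ring

theorem hB_commute_of_lt (β : ℕ) (γ : ℝ) {i j : Fin N} (h : i < j) :
    Commute (hB β γ i) (hB β γ j) := by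
  rw [hB_eq, hB_eq]
  refine hB_commute_aux (P := (β : ℂ) • pairOp i j) (Q := (β : ℂ) •
    ∑ k ∈ (Finset.univ.filter (fun k : Fin N => k < j)).erase i, pairOp j k)
    (oscOp_commutator β γ h.ne) ?_ ?_ ?_ ?_ ?_
  · refine (Commute.smul_left (Commute.sum_left _ _ _ fun k hk => ?_) _).eq
    exact pairOp_commute_oscOp β γ h.ne' ((Finset.mem_filter.mp hk).2.trans h).ne'
  · rw [jucysOp, ← smul_add, pairOp_symm, Finset.add_sum_erase _ _ (by simpa using h)]
  · refine (Commute.smul_left (Commute.sum_left _ _ _ fun k hk => ?_) _).eq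
    exact pairOp_commute_oscOp β γ h.ne (Finset.mem_erase.mp hk).1.symm
  · rw [smul_mul_assoc, mul_smul_comm, pairOp_mul_oscOp]
  · refine Commute.eq (Commute.smul_left (Commute.smul_right
      (Commute.sum_left _ _ _ fun k hk => ?_) _) _)
    exact pairOp_commute_jucysOp h ((Finset.mem_filter.mp hk).2.trans h)

theorem hB_commute (β : ℕ) (γ : ℝ) (i j : Fin N) : Commute (hB β γ i) (hB β γ j) := by
  rcases lt_trichotomy i j with h | h | h
  · exact hB_commute_of_lt β γ h
  · rw [h]
  · exact (hB_commute_of_lt β γ h).symm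

theorem signOp_commute_hB (β : ℕ) (γ : ℝ) (i j : Fin N) : Commute (signOp i) (hB β γ j) := by
  rw [hB_eq]
  exact (signOp_commute_oscOp β γ i j).add_right ((signOp_commute_jucysOp i j).smul_right _)

/-! ### Degenerate affine Hecke relations. -/

/-- The remainder in the degenerate affine Hecke relation for `s_{ij}` and `h_i`. -/
noncomputable def heckeRem (β : ℕ) (i j : Fin N) : Module.End ℂ (Poly N) :=
  (β : ℂ) • (1 + signOp i * signOp j)

theorem heckeRem_commute_hB (β : ℕ) (γ : ℝ) (i j l : Fin N) :
    Commute (heckeRem β i j) (hB β γ l) :=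
  ((Commute.one_left _).add_left ((signOp_commute_hB β γ i l).mul_left
    (signOp_commute_hB β γ j l))).smul_left _

theorem jucysOp_succ {i j : Fin N} (h : (i : ℕ) + 1 = j) :
    jucysOp j = pairOp i j + ∑ k ∈ Finset.univ.filter (fun k : Fin N => k < i), pairOp j k := by
  have h1 : Finset.univ.filter (fun k : Fin N => k < j)
      = insert i (Finset.univ.filter (fun k : Fin N => k < i)) := by
    ext k
    simp only [Finset.mem_filter, Finset.mem_univ, true_and, Finset.mem_insert, Fin.lt_def,
      Fin.ext_iff]
    omega
  rw [jucysOp, h1, Finset.sum_insert (by simp), pairOp_symm]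

theorem swap_mul_hB (β : ℕ) (γ : ℝ) {i j : Fin N} (h : (i : ℕ) + 1 = j) :
    permOp (Equiv.swap i j) * hB β γ i + heckeRem β i j
      = hB β γ j * permOp (Equiv.swap i j) := by
  have h1 := permOp_mul_jucysOp (Equiv.swap i j) i
  have h2 : ∑ k ∈ Finset.univ.filter (fun k : Fin N => k < i),
      pairOp (Equiv.swap i j i) (Equiv.swap i j k)
      = ∑ k ∈ Finset.univ.filter (fun k : Fin N => k < i), pairOp j k := by
    refine Finset.sum_congr rfl fun k hk => ?_
    have hk' : k < i := (Finset.mem_filter.mp hk).2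
    have hij : i < j := by rw [Fin.lt_def]; omega
    rw [Equiv.swap_apply_left, Equiv.swap_apply_of_ne_of_ne hk'.ne (hk'.trans hij).ne]
  rw [h2] at h1
  have h3 : pairOp i j * permOp (Equiv.swap i j) = 1 + signOp i * signOp j := by
    rw [pairOp_eq, mul_assoc, permOp_swap_mul_self, mul_one]
  rw [hB_eq, hB_eq, mul_add, add_mul, permOp_mul_oscOp, Equiv.swap_apply_left, mul_smul_comm, h1,
    smul_mul_assoc, jucysOp_succ h, add_mul, h3, heckeRem]
  module

/-- Multiply the preceding relation by the transposition on both sides; it squares to one and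
commutes with the remainder. -/
theorem swap_mul_hB' (β : ℕ) (γ : ℝ) {i j : Fin N} (h : (i : ℕ) + 1 = j) :
    permOp (Equiv.swap i j) * hB β γ j
      = hB β γ i * permOp (Equiv.swap i j) + heckeRem β i j := by
  have key : ∀ {R : Type} [Ring R] (s a b e : R), s * s = 1 → s * e = e * s → s * a + e = b * s →
      s * b = a * s + e := by
    intro R _ s a b e hs he hab
    calc s * b = s * (b * s) * s := by rw [mul_assoc, mul_assoc, hs, mul_one]
      _ = _ := by
        rw [← hab, mul_add, ← mul_assoc, hs, one_mul, he, add_mul, mul_assoc, hs, mul_one]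
  refine key _ _ _ _ (permOp_swap_mul_self i j) ?_ (swap_mul_hB β γ h)
  rw [heckeRem, mul_smul_comm, smul_mul_assoc, mul_add, add_mul, ← mul_assoc, permOp_mul_signOp,
    mul_assoc, permOp_mul_signOp, Equiv.swap_apply_left, Equiv.swap_apply_right, ← mul_assoc,
    (signOp_comm i j).eq, mul_one, one_mul]

/-- Adjacency matters: `i` and `j` lie on the same side of `l`, so the swap preserves the indices
below `l`. -/
theorem swap_commute_hB (β : ℕ) (γ : ℝ) {i j l : Fin N} (h : (i : ℕ) + 1 = j) (hi : l ≠ i)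
    (hj : l ≠ j) : permOp (Equiv.swap i j) * hB β γ l = hB β γ l * permOp (Equiv.swap i j) := by
  have h1 := permOp_mul_oscOp β γ (Equiv.swap i j) l
  rw [Equiv.swap_apply_of_ne_of_ne hi hj] at h1
  have h2 : Commute (permOp (Equiv.swap i j)) (jucysOp l) := by
    refine permOp_commute_jucysOp (Equiv.swap_apply_of_ne_of_ne hi hj) fun k => ?_
    rw [ne_eq, Fin.ext_iff] at hi hj
    rw [Equiv.swap_apply_def]
    split_ifs with h1 h2
    · rw [h1, Fin.lt_def, Fin.lt_def]; omega
    · rw [h2, Fin.lt_def, Fin.lt_def]; omega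
    · rfl
  rw [hB_eq]
  exact (Commute.add_right h1 (h2.smul_right _)).eq

/-! ### Symmetry and logarithmic derivative of `𝒳`. -/

theorem pderiv_prod {ι : Type*} [DecidableEq ι] (j : Fin N) (s : Finset ι) (f : ι → Poly N) :
    pderiv j (∏ p ∈ s, f p) = ∑ p ∈ s, (∏ q ∈ s.erase p, f q) * pderiv j (f p) := by
  induction s using Finset.induction_on with
  | empty => simp
  | insert a s ha ih =>
    rw [Finset.prod_insert ha, Derivation.leibniz, ih, Finset.sum_insert ha,
      Finset.erase_insert ha, smul_eq_mul, smul_eq_mul, Finset.mul_sum, add_comm]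
    congr 1
    refine Finset.sum_congr rfl fun p hp => ?_
    have hpa : p ≠ a := fun h => ha (h ▸ hp)
    rw [Finset.erase_insert_of_ne hpa.symm, Finset.prod_insert (fun h => ha (Finset.mem_of_mem_erase h)),
      mul_assoc]

/-- The nodes are `-z_i²` because the Vandermonde factors are `v_j - v_i` for `i < j`. Row
permutation of the determinant then gives the sign rule for `𝒳`. -/
theorem XL_eq_det : XL N = (Matrix.vandermonde fun i : Fin N => -(X i : Poly N) ^ 2).det := by
  rw [Matrix.det_vandermonde, XL, Finset.prod_sigma']
  refine Finset.prod_bij' (fun p _ => ⟨p.1, p.2⟩) (fun p _ => (p.1, p.2)) ?_ ?_ ?_ ?_ ?_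
  · simp
  · simp
  · simp
  · simp
  · intro p _; ring

theorem rename_XL (π : Equiv.Perm (Fin N)) :
    rename π (XL N) = ((Equiv.Perm.sign π : ℤ) : Poly N) * XL N := by
  have h := Matrix.det_permute π (Matrix.vandermonde fun i : Fin N => -(X i : Poly N) ^ 2)
  rw [← XL_eq_det] at h
  rw [← h, XL_eq_det, AlgHom.map_det]
  congr 1
  ext1 i k
  simp [Matrix.vandermonde]

theorem signHom_XL (j : Fin N) : signHom j (XL N) = XL N := by
  have h : ∀ i : Fin N, signHom j (X i : Poly N) ^ 2 = X i ^ 2 := fun i => by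
    rw [signHom_X]; split_ifs <;> simp
  simp only [XL, map_prod, map_sub, map_pow, h]

/-- The logarithmic derivative of `𝒳`. -/
theorem exists_pderiv_XL (j : Fin N) : ∃ U : Fin N → Poly N,
    (∀ k, k ≠ j → (X j ^ 2 - X k ^ 2) * U k = XL N) ∧
      pderiv j (XL N) = ∑ k : {k : Fin N // k ≠ j}, 2 * X j * U k.1 := by
  classical
  set s := Finset.univ.filter (fun p : Fin N × Fin N => p.1 < p.2) with hs
  set e : Fin N → Fin N × Fin N := fun k => if j < k then (j, k) else (k, j) with he
  have hmem : ∀ k, k ≠ j → e k ∈ s := fun k hk => by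
    simp only [hs, he, Finset.mem_filter, Finset.mem_univ, true_and]
    split_ifs with h
    · exact h
    · exact lt_of_le_of_ne (not_lt.mp h) hk
  have hsq : ∀ k, pderiv j ((X k : Poly N) ^ 2) = if k = j then 2 * X j else 0 := fun k => by
    rw [Derivation.leibniz_pow, pderiv_X, Pi.single_apply]
    by_cases h : k = j
    · subst h; simp
    · rw [if_neg h, if_neg h]; simp
  -- `U k` is `𝒳 / (z_j² - z_k²)`; pairs are stored in increasing order, whence the sign when `k <
  -- j`.
  refine ⟨fun k => (if j < k then 1 else -1) * ∏ q ∈ s.erase (e k), (X q.1 ^ 2 - X q.2 ^ 2), ?_, ?_⟩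
  · intro k hk
    have h := Finset.mul_prod_erase s (fun q => (X q.1 ^ 2 - X q.2 ^ 2 : Poly N)) (hmem k hk)
    rw [XL, ← h]
    simp only [he]
    split_ifs <;> ring
  · rw [XL, pderiv_prod]
    symm
    refine Finset.sum_of_injOn (fun k : {k : Fin N // k ≠ j} => e k.1) ?_ ?_ ?_ ?_
    · intro a _ b _ hab
      obtain ⟨a, ha⟩ := a
      obtain ⟨b, hb⟩ := b
      simp only [he] at hab
      apply Subtype.ext
      split_ifs at hab <;> simp_all [Prod.ext_iff]
    · intro a _; exact hmem a.1 a.2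
    · intro p hp hpe
      have hlt : p.1 < p.2 := (Finset.mem_filter.mp hp).2
      have h1 : p.1 ≠ j := fun h => hpe ⟨⟨p.2, fun h' => by simp [h, h'] at hlt⟩, by simp, by
        simp only [he]; rw [if_pos (h ▸ hlt), ← h]⟩
      have h2 : p.2 ≠ j := fun h => hpe ⟨⟨p.1, h1⟩, by simp, by
        simp only [he]; rw [if_neg (not_lt.mpr (h ▸ hlt.le)), ← h]⟩
      rw [map_sub, hsq, hsq, if_neg h1, if_neg h2, sub_zero, mul_zero]
    · rintro ⟨k, hk⟩ _
      simp only [he, map_sub, hsq]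
      split_ifs <;> simp_all <;> ring

/-! ### Self-adjointness with respect to an invariant functional. -/

/-- An abstract Gaussian-type functional on polynomials: invariant under the group `B_N` and
satisfying the integration by parts rule for the weight `∏ |z_j| ^ (2 γ) * exp (-z_j ^ 2)`. -/
structure IsWeightFunctional (γ : ℝ) (L : Poly N →ₗ[ℂ] ℂ) : Prop where
  rename : ∀ (π : Equiv.Perm (Fin N)) (p : Poly N), L (MvPolynomial.rename π p) = L p
  sign : ∀ (j : Fin N) (p : Poly N), L (signHom j p) = L p
  parts : ∀ (j : Fin N) (p : Poly N),
    L (pderiv j p) + γ * L (signQuot j p) = L (2 * X j * p)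

theorem rename_XL_pow (π : Equiv.Perm (Fin N)) (β : ℕ) :
    rename π (XL N ^ (2 * β)) = XL N ^ (2 * β) := by
  rw [map_pow, rename_XL, pow_mul, mul_pow]
  have h : ((Equiv.Perm.sign π : ℤ) : Poly N) ^ 2 = 1 := by
    rw [← Int.cast_pow, ← Units.val_pow_eq_pow_val, Int.units_sq]; simp
  rw [h, one_mul, ← pow_mul]

theorem signHom_XL_pow (j : Fin N) (n : ℕ) : signHom j (XL N ^ n) = XL N ^ n := by
  rw [map_pow, signHom_XL]

/-- Expanding `d * divDiff f = f - w f` against `V = W / d` leaves `2 f g V` minus a cross term.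
That term is odd under the involution `w`, since `w V = -V`, so `L` kills it. -/
theorem divDiff_form (L : Poly N →ₗ[ℂ] ℂ) (w : Poly N →ₐ[ℂ] Poly N) (d : Poly N) (hd : d ≠ 0)
    (h : ∀ i, d ∣ X i - w (X i)) (hL : ∀ p, L (w p) = L p) (hww : ∀ p, w (w p) = p)
    (hwd : w d = -d) {V W : Poly N} (hV : d * V = W) (hW : w W = W) (f g : Poly N) :
    L (divDiff w d hd h f * g * W) + L (f * divDiff w d hd h g * W) = 2 * L (f * g * V) := by
  have hwV : w V = -V := by
    apply mul_left_cancel₀ hd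
    rw [mul_neg, hV, ← neg_eq_iff_eq_neg, ← neg_mul, ← hwd, ← map_mul, hV, hW]
  have hf := mul_divDiff w d hd h f
  have hg := mul_divDiff w d hd h g
  have h1 : divDiff w d hd h f * g * W + f * divDiff w d hd h g * W
      = (2 : ℂ) • (f * g * V) - (w f * g + f * w g) * V := by
    rw [← hV, MvPolynomial.smul_eq_C_mul, map_ofNat]
    linear_combination g * V * hf + f * V * hg
  have h2 : L ((w f * g + f * w g) * V) = 0 := by
    have h3 := hL ((w f * g + f * w g) * V)
    rw [map_mul w, map_add w, map_mul w, map_mul w, hww, hww, hwV, mul_neg, map_neg,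
      add_comm (f * w g)] at h3
    exact CharZero.neg_eq_self_iff.mp h3
  rw [← map_add, h1, map_sub, h2, sub_zero, map_smul, smul_eq_mul]

theorem swapHom_swapHom (j k : Fin N) (p : Poly N) : swapHom j k (swapHom j k p) = p :=
  LinearMap.congr_fun (permOp_swap_mul_self j k) p

theorem signHom_signHom (j : Fin N) (p : Poly N) : signHom j (signHom j p) = p :=
  LinearMap.congr_fun (signOp_mul_self j) p

theorem signSwap_mul_self (j k : Fin N) :
    signOp j * signOp k * permOp (Equiv.swap j k) * (signOp j * signOp k * permOp (Equiv.swap j k))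
      = 1 := by
  have key : ∀ {R : Type} [Ring R] (s t u : R), s * s = 1 → t * t = 1 → u * u = 1 →
      t * u = u * t → s * t = u * s → s * u = t * s → t * u * s * (t * u * s) = 1 := by
    intro R _ s t u hs ht hu htu h1 h2
    calc t * u * s * (t * u * s) = t * u * (s * t) * u * s := by noncomm_ring
      _ = t * (u * u) * (s * u) * s := by rw [h1]; noncomm_ring
      _ = t * t * (s * s) := by rw [hu, h2]; noncomm_ring
      _ = 1 := by rw [hs, ht, one_mul]
  refine key _ _ _ (permOp_swap_mul_self j k) (signOp_mul_self j) (signOp_mul_self k)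
    (signOp_comm j k).eq ?_ ?_
  · rw [permOp_mul_signOp, Equiv.swap_apply_left]
  · rw [permOp_mul_signOp, Equiv.swap_apply_right]

theorem signSwapHom_signSwapHom (j k : Fin N) (p : Poly N) :
    signSwapHom j k (signSwapHom j k p) = p :=
  LinearMap.congr_fun (signSwap_mul_self j k) p

theorem involution_form (L : Poly N →ₗ[ℂ] ℂ) {w : Poly N →ₐ[ℂ] Poly N} (hw : ∀ p, L (w p) = L p)
    (hww : ∀ p, w (w p) = p) {W : Poly N} (hW : w W = W) (f g : Poly N) :
    L (w f * g * W) = L (f * w g * W) := by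
  rw [← hw (w f * g * W), map_mul w, map_mul w, hww, hW]

namespace IsWeightFunctional

variable {γ : ℝ} {L : Poly N →ₗ[ℂ] ℂ} (hL : IsWeightFunctional γ L)

include hL

theorem signSwap (j k : Fin N) (p : Poly N) : L (signSwapHom j k p) = L p := by
  rw [signSwapHom, AlgHom.comp_apply, AlgHom.comp_apply, hL.sign, hL.sign]
  exact hL.rename _ p

theorem signQuot_form (j : Fin N) {W : Poly N} (hW : signHom j W = W) (f g : Poly N) :
    L (signQuot j f * g * W) + L (f * signQuot j g * W) = L (signQuot j (f * g * W)) := by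
  have hz : (X j : Poly N) ≠ 0 := MvPolynomial.X_ne_zero j
  have hq : ∀ p : Poly N, X j * signQuot j p = p - signHom j p := fun p => mul_divDiff _ _ _ _ p
  have ht : ∀ p : Poly N, signHom j (signQuot j p) = signQuot j p := fun p => by
    have h1 := congrArg (signHom j) (hq p)
    rw [map_mul, map_sub, signHom_signHom, signHom_X, if_pos rfl] at h1
    apply mul_left_cancel₀ hz
    linear_combination -h1 - hq p
  have hodd : L (X j * (signQuot j f * signQuot j g * W)) = 0 := by
    have h3 := hL.sign j (X j * (signQuot j f * signQuot j g * W))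
    rw [map_mul (signHom j), map_mul (signHom j), map_mul (signHom j), ht, ht, hW, signHom_X, if_pos rfl, neg_mul, map_neg] at h3
    exact CharZero.neg_eq_self_iff.mp h3
  -- Twisted Leibniz rule; the correction term is odd in `z_j`, since the quotients and `W` are
  -- even.
  have h4 : signQuot j (f * g * W) = signQuot j f * g * W + f * signQuot j g * W
      - X j * (signQuot j f * signQuot j g * W) := by
    apply mul_left_cancel₀ hz
    rw [hq, map_mul, map_mul, hW]
    linear_combination (-(g * W) + (g - signHom j g) * W) * hq f +
      (-(f * W) + X j * signQuot j f * W) * hq g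
  rw [h4, map_sub, hodd, sub_zero, map_add]

/-- Integration by parts for `D_j`: the difference terms supply exactly the contribution of `∂_j`
acting on `W`, and the `γ` term is built into the functional. -/
theorem dunkl_form (β : ℕ) (j : Fin N) (f g : Poly N) :
    L (dunkl β γ j f * g * XL N ^ (2 * β)) + L (f * dunkl β γ j g * XL N ^ (2 * β))
      = L (2 * X j * (f * g * XL N ^ (2 * β))) := by
  set W := XL N ^ (2 * β) with hWdef
  have hβ : (β : ℂ) * ∑ k : {k : Fin N // k ≠ j},
      ((L (swapQuot j k.1 k.2 f * g * W) + L (f * swapQuot j k.1 k.2 g * W)) +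
        (L (signSwapQuot j k.1 k.2 f * g * W) + L (f * signSwapQuot j k.1 k.2 g * W)))
      = L (f * g * pderiv j W) := by
    -- `β = 0` is separate because the exponent `2 * β - 1` below is truncated.
    rcases Nat.eq_zero_or_pos β with h0 | hpos
    · subst h0; simp [hWdef]
    obtain ⟨U, hU, hdU⟩ := exists_pderiv_XL j
    have hWs : W = XL N ^ (2 * β - 1) * XL N := by
      rw [hWdef, ← pow_succ]; congr 1; omega
    have hdW : pderiv j W = ∑ k : {k : Fin N // k ≠ j},
        (β : ℂ) • (4 * X j * U k.1 * XL N ^ (2 * β - 1)) := by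
      rw [hWdef, Derivation.leibniz_pow, hdU, Finset.smul_sum, Finset.smul_sum]
      refine Finset.sum_congr rfl fun k _ => ?_
      rw [MvPolynomial.smul_eq_C_mul, nsmul_eq_mul, smul_eq_mul, map_natCast]
      push_cast
      ring
    rw [hdW, Finset.mul_sum, Finset.mul_sum, map_sum]
    refine Finset.sum_congr rfl fun k _ => ?_
    have h1 := divDiff_form L (swapHom j k.1) (X j - X k.1) (X_sub_X_ne_zero k.2) (swap_dvd j k.1)
      (hL.rename _) (swapHom_swapHom j k.1) (by simp [swapHom_X])
      (V := (X j + X k.1) * U k.1 * XL N ^ (2 * β - 1)) (W := W)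
      (by rw [hWs, ← hU k.1 k.2]; ring) (rename_XL_pow _ _) f g
    have h2 := divDiff_form L (signSwapHom j k.1) (X j + X k.1) (X_add_X_ne_zero k.2)
      (signSwap_dvd k.2) (hL.signSwap j k.1) (signSwapHom_signSwapHom j k.1)
      (by simp [signSwapHom_X, signHom_X, k.2, k.2.symm])
      (V := (X j - X k.1) * U k.1 * XL N ^ (2 * β - 1)) (W := W)
      (by rw [hWs, ← hU k.1 k.2]; ring)
      (by
        rw [signSwapHom, AlgHom.comp_apply, AlgHom.comp_apply, hWdef]
        erw [rename_XL_pow]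
        rw [signHom_XL_pow, signHom_XL_pow]) f g
    rw [swapQuot, signSwapQuot, h1, h2, mul_smul_comm, map_smul, smul_eq_mul, ← mul_add, ← map_add]
    congr 1
    -- `2 z_j = (z_j + z_k) + (z_j - z_k)` splits the derivative between the two reflections.
    have h3 : f * g * (4 * X j * U k.1 * XL N ^ (2 * β - 1))
      = (2 : ℂ) • (f * g * ((X j + X k.1) * U k.1 * XL N ^ (2 * β - 1)) +
        f * g * ((X j - X k.1) * U k.1 * XL N ^ (2 * β - 1))) := by
      rw [MvPolynomial.smul_eq_C_mul, map_ofNat]; ring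
    rw [h3, map_smul, smul_eq_mul]
  have hγ := hL.signQuot_form j (signHom_XL_pow j (2 * β)) f g
  have hexp : ∀ p : Poly N, dunkl β γ j p = pderiv j p + (β : ℂ) •
      (∑ k : {k : Fin N // k ≠ j}, (swapQuot j k.1 k.2 p + signSwapQuot j k.1 k.2 p))
      + (γ : ℂ) • signQuot j p := fun p => by
    simp [dunkl, LinearMap.sum_apply]
  have hleib : pderiv j (f * g * W) = pderiv j f * g * W + f * pderiv j g * W
      + f * g * pderiv j W := by
    rw [Derivation.leibniz, Derivation.leibniz]; simp only [smul_eq_mul]; ring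
  rw [← hL.parts, hleib, ← hγ, map_add, map_add, ← hβ, hexp, hexp]
  simp only [add_mul, mul_add, map_add, smul_mul_assoc, mul_smul_comm, map_smul, Finset.sum_mul,
    Finset.mul_sum, map_sum, smul_eq_mul, Finset.sum_add_distrib]
  ring

theorem raiseOp_form (β : ℕ) (j : Fin N) (f g : Poly N) :
    L (dunkl β γ j f * g * XL N ^ (2 * β)) = L (f * raiseOp β γ j g * XL N ^ (2 * β)) := by
  have h : f * raiseOp β γ j g * XL N ^ (2 * β)
      = 2 * X j * (f * g * XL N ^ (2 * β)) - f * dunkl β γ j g * XL N ^ (2 * β) := by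
    rw [raiseOp, LinearMap.sub_apply, mulOp_apply]; ring
  rw [h, map_sub, ← hL.dunkl_form, add_sub_cancel_right]

theorem oscOp_form (β : ℕ) (j : Fin N) (f g : Poly N) :
    L (oscOp β γ j f * g * XL N ^ (2 * β)) = L (f * oscOp β γ j g * XL N ^ (2 * β)) := by
  rw [oscOp_eq, LinearMap.smul_apply, LinearMap.smul_apply, smul_mul_assoc, smul_mul_assoc,
    mul_smul_comm, smul_mul_assoc, map_smul, map_smul, Module.End.mul_apply, Module.End.mul_apply,
    mul_comm _ g, ← hL.raiseOp_form, ← hL.raiseOp_form, mul_comm (dunkl β γ j g)]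

theorem pairOp_form (β : ℕ) (j k : Fin N) (f g : Poly N) :
    L (pairOp j k f * g * XL N ^ (2 * β)) = L (f * pairOp j k g * XL N ^ (2 * β)) := by
  have hW : signSwapHom j k (XL N ^ (2 * β)) = XL N ^ (2 * β) := by
    rw [signSwapHom, AlgHom.comp_apply, AlgHom.comp_apply]
    erw [rename_XL_pow]
    rw [signHom_XL_pow, signHom_XL_pow]
  have h1 := involution_form L (hL.rename _) (swapHom_swapHom j k)
    (rename_XL_pow (Equiv.swap j k) β) f g
  have h2 := involution_form L (hL.signSwap j k) (signSwapHom_signSwapHom j k) hW f g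
  simp only [pairOp, LinearMap.add_apply, AlgHom.toLinearMap_apply, add_mul, mul_add, map_add]
  exact congrArg₂ _ h1 h2

theorem hB_form (β : ℕ) (j : Fin N) (f g : Poly N) :
    L (hB β γ j f * g * XL N ^ (2 * β)) = L (f * hB β γ j g * XL N ^ (2 * β)) := by
  simp only [hB_eq, jucysOp, LinearMap.add_apply, LinearMap.smul_apply, LinearMap.sum_apply,
    add_mul, mul_add, map_add, smul_mul_assoc, mul_smul_comm, map_smul, Finset.sum_mul,
    Finset.mul_sum, map_sum, hL.oscOp_form, hL.pairOp_form]

end IsWeightFunctional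

/-! ### Moments and the concrete weight functional. -/

/-- The one-dimensional weight `(|x| ^ γ * exp (-x ^ 2 / 2)) ^ 2`. -/
noncomputable def lineWeight (γ : ℝ) (x : ℝ) : ℝ := (|x| ^ γ * Real.exp (-x ^ 2 / 2)) ^ 2

/-- The moments of `lineWeight`. -/
noncomputable def moment (γ : ℝ) (a : ℕ) : ℝ := ∫ x : ℝ, x ^ a * lineWeight γ x

theorem lineWeight_neg (γ x : ℝ) : lineWeight γ (-x) = lineWeight γ x := by
  simp [lineWeight]

theorem pow_mul_lineWeight_of_pos (γ : ℝ) (a : ℕ) {x : ℝ} (hx : 0 < x) :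
    x ^ a * lineWeight γ x = x ^ ((a : ℝ) + 2 * γ) * Real.exp (-x ^ (2 : ℝ)) := by
  rw [lineWeight, abs_of_pos hx, mul_pow, ← Real.rpow_mul_natCast hx.le, ← Real.exp_nat_mul,
    Real.rpow_add hx, Real.rpow_natCast, Real.rpow_two, mul_assoc]
  congr 3
  · push_cast; ring_nf
  · push_cast; ring

/-- Integrability at the origin needs `a + 2γ > -1`, which `γ > -1/2` ensures for every `a ≥ 0`. -/
theorem integrable_pow_mul_lineWeight {γ : ℝ} (hγ : -1 / 2 < γ) (a : ℕ) :
    Integrable fun x : ℝ => x ^ a * lineWeight γ x := by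
  have hpos : IntegrableOn (fun x : ℝ => x ^ a * lineWeight γ x) (Set.Ioi 0) := by
    have ha : (0 : ℝ) ≤ a := a.cast_nonneg
    refine (integrableOn_rpow_mul_exp_neg_rpow (s := (a : ℝ) + 2 * γ) (by linarith)
      two_pos).congr_fun (fun x hx => ?_) measurableSet_Ioi
    exact (pow_mul_lineWeight_of_pos γ a hx).symm
  rw [← integrableOn_univ, ← @Set.Iio_union_Ici _ _ (0 : ℝ), integrableOn_union,
    integrableOn_Ici_iff_integrableOn_Ioi]
  refine ⟨?_, hpos⟩
  rw [← (Measure.measurePreserving_neg (volume : Measure ℝ)).integrableOn_comp_preimage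
      (Homeomorph.neg ℝ).measurableEmbedding]
  simp only [Function.comp_def, Set.neg_preimage, Set.neg_Iio, neg_zero, lineWeight_neg]
  refine (hpos.const_mul ((-1 : ℝ) ^ a)).congr (Filter.Eventually.of_forall fun x => ?_)
  simp only [neg_pow x, mul_assoc]

theorem moment_odd (γ : ℝ) {a : ℕ} (ha : Odd a) : moment γ a = 0 := by
  have h := integral_neg_eq_self (fun x : ℝ => x ^ a * lineWeight γ x) volume
  simp only [lineWeight_neg, ha.neg_pow, neg_mul, integral_neg] at h
  exact self_eq_neg.mp h.symm

theorem moment_even {γ : ℝ} (hγ : -1 / 2 < γ) {a : ℕ} (ha : Even a) :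
    moment γ a = Real.Gamma (((a : ℝ) + 2 * γ + 1) / 2) := by
  have h : moment γ a = ∫ x : ℝ, (fun y : ℝ => y ^ a * lineWeight γ y) |x| := by
    refine integral_congr_ae (Filter.Eventually.of_forall fun x => ?_)
    simp only [ha.pow_abs, lineWeight, abs_abs, sq_abs]
  have ha' : (0 : ℝ) ≤ a := a.cast_nonneg
  rw [h, integral_comp_abs (f := fun y : ℝ => y ^ a * lineWeight γ y), setIntegral_congr_fun measurableSet_Ioi
    (fun x hx => pow_mul_lineWeight_of_pos γ a hx),
    integral_rpow_mul_exp_neg_rpow two_pos (by linarith)]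
  ring

/-- This is `Γ(x + 1) = x Γ(x)`. It replaces analytic integration by parts, so the singularity of
`|x|^(2γ)` at `0` causes no boundary terms. -/
theorem moment_add_two {γ : ℝ} (hγ : -1 / 2 < γ) {a : ℕ} (ha : Even a) :
    ((a : ℝ) + 1 + 2 * γ) * moment γ a = 2 * moment γ (a + 2) := by
  have ha' : (0 : ℝ) ≤ a := a.cast_nonneg
  rw [moment_even hγ ha, moment_even hγ (ha.add even_two)]
  have h1 : (((a + 2 : ℕ) : ℝ) + 2 * γ + 1) / 2 = ((a : ℝ) + 2 * γ + 1) / 2 + 1 := by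
    push_cast; ring
  have h2 : (0 : ℝ) < ((a : ℝ) + 2 * γ + 1) / 2 := by linarith
  rw [h1, Real.Gamma_add_one h2.ne']
  ring

/-- The functional `p ↦ ∫ p(z) ∏ |z_j| ^ (2 γ) exp (-z_j ^ 2) dz` on polynomials, given by its
values on monomials. -/
noncomputable def weightFunctional (N : ℕ) (γ : ℝ) : Poly N →ₗ[ℂ] ℂ :=
  (basisMonomials (Fin N) ℂ).constr ℂ fun a => ∏ i, ((moment γ (a i) : ℝ) : ℂ)

theorem weightFunctional_monomial (γ : ℝ) (a : Fin N →₀ ℕ) (c : ℂ) :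
    weightFunctional N γ (monomial a c) = c * ∏ i, ((moment γ (a i) : ℝ) : ℂ) := by
  have h : (monomial a c : Poly N) = c • basisMonomials (Fin N) ℂ a := by
    rw [coe_basisMonomials, smul_monomial, smul_eq_mul, mul_one]
  rw [h, map_smul, weightFunctional, Module.Basis.constr_basis, smul_eq_mul]

theorem integral_toFn_mul_weight {γ : ℝ} (hγ : -1 / 2 < γ) (p : Poly N) :
    Integrable (fun z : Fin N → ℝ => toFn p z * ((∏ i, lineWeight γ (z i) : ℝ) : ℂ)) ∧
      ∫ z : Fin N → ℝ, toFn p z * ((∏ i, lineWeight γ (z i) : ℝ) : ℂ)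
        = weightFunctional N γ p := by
  induction p using MvPolynomial.induction_on' with
  | monomial u c =>
    have h : (fun z : Fin N → ℝ =>
        toFn (monomial u c) z * ((∏ i, lineWeight γ (z i) : ℝ) : ℂ))
        = fun z => c * ∏ i, (((z i) ^ (u i) * lineWeight γ (z i) : ℝ) : ℂ) := by
      funext z
      rw [toFn, eval_monomial, Finsupp.prod_fintype _ _ (fun i => pow_zero _), mul_assoc]
      congr 1
      push_cast
      rw [Finset.prod_mul_distrib]
    rw [h]
    constructor
    · exact (Integrable.fintype_prod (f := fun i (x : ℝ) => ((x ^ (u i) * lineWeight γ x : ℝ) : ℂ))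
        fun i => (integrable_pow_mul_lineWeight hγ (u i)).ofReal).const_mul c
    · rw [integral_const_mul, weightFunctional_monomial, integral_fintype_prod_volume_eq_prod
        (f := fun i (x : ℝ) => ((x ^ (u i) * lineWeight γ x : ℝ) : ℂ))]
      simp only [integral_complex_ofReal, moment]
  | add p q hp hq =>
    have h : (fun z : Fin N → ℝ => toFn (p + q) z * ((∏ i, lineWeight γ (z i) : ℝ) : ℂ))
        = fun z => toFn p z * ((∏ i, lineWeight γ (z i) : ℝ) : ℂ)
          + toFn q z * ((∏ i, lineWeight γ (z i) : ℝ) : ℂ) := by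
      funext z; rw [toFn, map_add, add_mul]; rfl
    rw [h]
    exact ⟨hp.1.add hq.1, by rw [integral_add hp.1 hq.1, hp.2, hq.2, map_add]⟩

theorem signHom_monomial (j : Fin N) (a : Fin N →₀ ℕ) (c : ℂ) :
    signHom j (monomial a c) = (-1 : ℂ) ^ a j • monomial a c := by
  classical
  rw [monomial_eq, map_mul, Finsupp.prod_fintype _ _ (fun i => pow_zero _), map_prod]
  have h : ∀ i, signHom j ((X i : Poly N) ^ a i)
      = (if i = j then C ((-1 : ℂ) ^ a j) else 1) * X i ^ a i := fun i => by
    rw [map_pow, signHom_X]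
    split_ifs with hi
    · subst hi; rw [neg_pow, map_pow, map_neg, map_one]
    · rw [one_mul]
  have hC : signHom j (C c : Poly N) = C c := (signHom j).commutes c
  rw [hC, Finset.prod_congr rfl fun i _ => h i, Finset.prod_mul_distrib,
    Finset.prod_ite_eq' Finset.univ j, if_pos (Finset.mem_univ j), smul_eq_C_mul]
  ring

theorem linearMap_eq_of_monomial {F G : Poly N →ₗ[ℂ] ℂ}
    (h : ∀ a, F (monomial a 1) = G (monomial a 1)) (p : Poly N) : F p = G p := by
  induction p using MvPolynomial.induction_on' with
  | monomial u c =>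
    have hc : (monomial u c : Poly N) = c • monomial u 1 := by
      rw [smul_monomial, smul_eq_mul, mul_one]
    rw [hc, map_smul, map_smul, h]
  | add p q hp hq => rw [map_add, map_add, hp, hq]

theorem weightFunctional_monomial_split (γ : ℝ) (j : Fin N) (a : Fin N →₀ ℕ) (c : ℂ) :
    weightFunctional N γ (monomial a c)
      = c * (moment γ (a j) * ∏ i ∈ Finset.univ.erase j, ((moment γ (a i) : ℝ) : ℂ)) := by
  rw [weightFunctional_monomial,
    ← Finset.mul_prod_erase Finset.univ (fun i => ((moment γ (a i) : ℝ) : ℂ)) (Finset.mem_univ j)]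

theorem signQuot_monomial (j : Fin N) (a : Fin N →₀ ℕ) (c : ℂ) :
    signQuot j (monomial a c : Poly N)
      = monomial (a - Finsupp.single j 1) (c * (1 - (-1) ^ a j)) := by
  apply divDiff_eq_of_mul_eq
  rw [signHom_monomial]
  have hX : (X j : Poly N) = monomial (Finsupp.single j 1) 1 := rfl
  rcases Nat.eq_zero_or_pos (a j) with h | h
  · rw [h]; simp
  · rw [hX, monomial_mul, add_tsub_cancel_of_le (Finsupp.single_le_iff.mpr h), one_mul,
      smul_monomial, smul_eq_mul, ← map_sub]
    congr 1; ring

theorem weightFunctional_parts_monomial {γ : ℝ} (hγ : -1 / 2 < γ) (j : Fin N) (a : Fin N →₀ ℕ)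
    (c : ℂ) :
    weightFunctional N γ (pderiv j (monomial a c))
        + γ * weightFunctional N γ (signQuot j (monomial a c))
      = weightFunctional N γ (2 * X j * monomial a c) := by
  have hX : (2 * X j * monomial a c : Poly N) = monomial (a + Finsupp.single j 1) (2 * c) := by
    have h2 : (2 : Poly N) = C 2 := (map_ofNat C 2).symm
    rw [h2, mul_assoc, X, monomial_mul, C_mul_monomial, add_comm a, one_mul]
  rw [hX, pderiv_monomial, signQuot_monomial,
    weightFunctional_monomial_split γ j, weightFunctional_monomial_split γ j,
    weightFunctional_monomial_split γ j]
  have h1 : ∏ i ∈ Finset.univ.erase j, ((moment γ ((a - Finsupp.single j 1 : Fin N →₀ ℕ) i) : ℝ) : ℂ)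
      = ∏ i ∈ Finset.univ.erase j, ((moment γ (a i) : ℝ) : ℂ) :=
    Finset.prod_congr rfl fun i hi => by
      simp [(Finset.ne_of_mem_erase hi).symm]
  have h2 : ∏ i ∈ Finset.univ.erase j, ((moment γ ((a + Finsupp.single j 1 : Fin N →₀ ℕ) i) : ℝ) : ℂ)
      = ∏ i ∈ Finset.univ.erase j, ((moment γ (a i) : ℝ) : ℂ) :=
    Finset.prod_congr rfl fun i hi => by
      simp [(Finset.ne_of_mem_erase hi).symm]
  rw [h1, h2, Finsupp.tsub_apply, Finsupp.add_apply, Finsupp.single_eq_same]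
  rcases Nat.even_or_odd (a j) with ha | ha
  · rw [moment_odd γ ha.add_one, ha.neg_one_pow]
    -- At exponent `0`, truncated subtraction leaves a nonzero moment, but the coefficient `a j`
    -- vanishes.
    rcases Nat.eq_zero_or_pos (a j) with h0 | h0
    · simp [h0]
    · rw [moment_odd γ (Nat.Even.sub_odd h0 ha odd_one)]; simp
  -- For exponent `2b + 1` the derivative contributes `2b + 1` and the sign quotient `2γ`: the
  -- recursion for moments.
  · obtain ⟨b, hb⟩ := ha
    have h3 := moment_add_two hγ (even_two_mul b)
    have h4 : ((2 * b : ℕ) + 1 + 2 * γ : ℂ) * (moment γ (2 * b) : ℂ)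
        = 2 * (moment γ (2 * b + 2) : ℂ) := by exact_mod_cast h3
    rw [hb, Odd.neg_one_pow ⟨b, rfl⟩, Nat.add_sub_cancel]
    push_cast at h4 ⊢
    linear_combination c * (∏ i ∈ Finset.univ.erase j, ((moment γ (a i) : ℝ) : ℂ)) * h4

theorem weightFunctional_parts {γ : ℝ} (hγ : -1 / 2 < γ) (j : Fin N) (p : Poly N) :
    weightFunctional N γ (pderiv j p) + γ * weightFunctional N γ (signQuot j p)
      = weightFunctional N γ (2 * X j * p) := by
  induction p using MvPolynomial.induction_on' with
  | monomial u c => exact weightFunctional_parts_monomial hγ j u c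
  | add p q hp hq =>
    rw [map_add, map_add, map_add, map_add, mul_add, mul_add, map_add, ← hp, ← hq]
    ring

theorem isWeightFunctional {γ : ℝ} (hγ : -1 / 2 < γ) :
    IsWeightFunctional γ (weightFunctional N γ) where
  rename π p := by
    refine linearMap_eq_of_monomial (F := weightFunctional N γ ∘ₗ permOp π) (fun a => ?_) p
    have h : permOp π (monomial a 1 : Poly N) = monomial (a.mapDomain π) 1 := rename_monomial _ _ _
    rw [LinearMap.comp_apply, h, weightFunctional_monomial, weightFunctional_monomial]
    congr 1
    refine Fintype.prod_equiv π.symm _ _ fun i => ?_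
    rw [Finsupp.mapDomain_equiv_apply]
  sign j p := by
    refine linearMap_eq_of_monomial (F := weightFunctional N γ ∘ₗ signOp j) (fun a => ?_) p
    have h : signOp j (monomial a 1 : Poly N) = (-1 : ℂ) ^ a j • monomial a 1 :=
      signHom_monomial _ _ _
    rw [LinearMap.comp_apply, h, map_smul]
    rcases Nat.even_or_odd (a j) with ha | ha
    · rw [ha.neg_one_pow, one_smul]
    · rw [weightFunctional_monomial_split γ j, moment_odd γ ha]; simp
  parts := weightFunctional_parts hγ

/-! ### From integrals to the functional. -/

theorem toFn_XL_pow (β : ℕ) (γ : ℝ) (z : Fin N → ℝ) :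
    ((groundState β γ z ^ 2 : ℝ) : ℂ)
      = toFn (XL N ^ (2 * β)) z * ((∏ i, lineWeight γ (z i) : ℝ) : ℂ) := by
  have hX : toFn (XL N) z = ((∏ p ∈ Finset.univ.filter (fun p : Fin N × Fin N => p.1 < p.2),
      (z p.1 ^ 2 - z p.2 ^ 2) : ℝ) : ℂ) := by
    simp [toFn, XL, map_prod]
  have h : toFn (XL N ^ (2 * β)) z = toFn (XL N) z ^ (2 * β) := map_pow _ _ _
  rw [h, hX, groundState, mul_pow, Finset.prod_pow, ← pow_mul, mul_comm β 2, pow_mul,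
    ← Finset.abs_prod, sq_abs, ← pow_mul, Complex.ofReal_mul, Complex.ofReal_pow,
    ← Finset.prod_pow]
  rfl

theorem integrandL_toFn (β : ℕ) (γ : ℝ) (f g : Poly N) (z : Fin N → ℝ) :
    integrandL β γ (toFn f) (toFn g) z
      = toFn (f * g * XL N ^ (2 * β)) z * ((∏ i, lineWeight γ (z i) : ℝ) : ℂ) := by
  have h : toFn (f * g * XL N ^ (2 * β)) z = toFn f z * toFn g z * toFn (XL N ^ (2 * β)) z := by
    simp only [toFn, map_mul]
  rw [integrandL, toFn_XL_pow, h]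
  ring

theorem integrandL_shiftG (β : ℕ) (γ : ℝ) (c : ℂ) (f g : Poly N) (z : Fin N → ℝ) :
    integrandL (β + 1) γ (shiftG β γ c f) (toFn g) z
      = integrandL β γ (toFn (YL β γ c f)) (toFn (XL N * g)) z := by
  have h1 : toFn (XL N ^ (2 * (β + 1))) z
      = toFn (XL N) z * toFn (XL N) z * toFn (XL N ^ (2 * β)) z := by
    have : XL N ^ (2 * (β + 1)) = XL N * XL N * XL N ^ (2 * β) := by ring
    rw [this]; simp only [toFn, map_mul]
  have h2 : toFn (XL N * g) z = toFn (XL N) z * toFn g z := map_mul _ _ _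
  rw [integrandL, integrandL, toFn_XL_pow, toFn_XL_pow, h1, h2, shiftG]
  -- With `0⁻¹ = 0` both sides vanish where `𝒳 = 0`, so the integrands agree everywhere, not just
  -- almost everywhere.
  by_cases h : toFn (XL N) z = 0
  · rw [h]; ring
  · field_simp

theorem innerL_toFn (β : ℕ) {γ : ℝ} (hγ : -1 / 2 < γ) (f g : Poly N) :
    innerL β γ (toFn f) (toFn g) = weightFunctional N γ (f * g * XL N ^ (2 * β)) := by
  rw [← (integral_toFn_mul_weight hγ _).2, innerL]
  simp only [integrandL_toFn]

theorem integrable_integrandL_toFn (β : ℕ) {γ : ℝ} (hγ : -1 / 2 < γ) (f g : Poly N) :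
    Integrable (integrandL β γ (toFn f) (toFn g)) := by
  have h : integrandL β γ (toFn f) (toFn g) = fun z => _ := funext (integrandL_toFn β γ f g)
  rw [h]
  exact (integral_toFn_mul_weight hγ _).1

/-! ### Polynomials in the operators `h_j / 2`. -/

theorem exists_aeval_of_commute {A : Type*} [Ring A] [Algebra ℂ A] {σ : Type*} (y : σ → A)
    (hy : ∀ i j, Commute (y i) (y j)) :
    ∃ ρ : MvPolynomial σ ℂ →ₐ[ℂ] A, ∀ i, ρ (X i) = y i := by
  have hc : ∀ a ∈ Set.range y, ∀ b ∈ Set.range y, a * b = b * a := by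
    rintro _ ⟨i, rfl⟩ _ ⟨j, rfl⟩; exact (hy i j).eq
  -- The ambient ring need not be commutative, so evaluation takes place in the commutative
  -- subalgebra generated by the family.
  let _ : CommSemiring (Algebra.adjoin ℂ (Set.range y)) :=
    { (Algebra.adjoin ℂ (Set.range y)).toSemiring with
      mul_comm := (Algebra.isMulCommutative_adjoin ℂ hc).is_comm.comm }
  refine ⟨(Algebra.adjoin ℂ (Set.range y)).val.comp
    (aeval fun i => ⟨y i, Algebra.subset_adjoin ⟨i, rfl⟩⟩), fun i => ?_⟩
  simp

/-- The correction term obeys the twisted Leibniz rule of a divided difference, so the Hecke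
relation passes from generators to products. -/
theorem hecke_mul_aux {R : Type*} [Ring R] {s e p sp d y sy dy : R}
    (hp : s * p = sp * s - d * e) (hy : s * y = sy * s - dy * e) (he : e * y = y * e) :
    s * (p * y) = sp * sy * s - (sp * dy + d * y) * e := by
  calc s * (p * y) = s * p * y := by noncomm_ring
    _ = sp * (s * y) - d * (e * y) := by rw [hp]; noncomm_ring
    _ = _ := by rw [hy, he]; noncomm_ring

section Hecke

variable {β : ℕ} {γ : ℝ} {ρ : Poly N →ₐ[ℂ] Module.End ℂ (Poly N)}

/-- The degenerate affine Hecke relation for polynomials in the operators `h_j / 2`. -/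
theorem swap_mul_aeval (hρ : ∀ i, ρ (X i) = (1 / 2 : ℂ) • hB β γ i) {i j : Fin N}
    (h : (i : ℕ) + 1 = j) (hij : j ≠ i) (p : Poly N) :
    permOp (Equiv.swap i j) * ρ p = ρ (swapHom i j p) * permOp (Equiv.swap i j)
      - ρ (swapQuot i j hij p) * ((1 / 2 : ℂ) • heckeRem β i j) := by
  induction p using MvPolynomial.induction_on with
  | C a =>
    have h1 : ρ (C a) = algebraMap ℂ _ a := ρ.commutes a
    have h2 : swapHom i j (C a : Poly N) = C a := (swapHom i j).commutes a
    have h3 : swapQuot i j hij (C a : Poly N) = 0 := divDiff_eq_of_mul_eq _ _ (by rw [h2]; simp)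
    rw [h2, h3, h1, map_zero, zero_mul, ← Algebra.commutes]
    exact (sub_zero _).symm
  | add p q hp hq =>
    have key : ∀ {R : Type} [Ring R] (s p q p' q' d d' e : R), s * p = p' * s - d * e →
        s * q = q' * s - d' * e → s * (p + q) = (p' + q') * s - (d + d') * e := by
      intro R _ s p q p' q' d d' e h1 h2
      rw [mul_add, h1, h2]; noncomm_ring
    rw [map_add, map_add, map_add, map_add, map_add]
    exact key _ _ _ _ _ _ _ _ hp hq
  | mul_X p l hp =>
    have hX : permOp (Equiv.swap i j) * ρ (X l)
        = ρ (swapHom i j (X l)) * permOp (Equiv.swap i j)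
          - ρ (swapQuot i j hij (X l)) * ((1 / 2 : ℂ) • heckeRem β i j) := by
      rw [swapHom_X, swapQuot_X, hρ, hρ, mul_smul_comm]
      by_cases hi : l = i
      · subst hi
        rw [if_pos rfl, Equiv.swap_apply_left, map_one, one_mul, smul_mul_assoc, ← swap_mul_hB β γ h,
          smul_add]
        exact (add_sub_cancel_right _ _).symm
      by_cases hj : l = j
      · subst hj
        rw [if_neg hi, if_pos rfl, Equiv.swap_apply_right, swap_mul_hB' β γ h, smul_add,
          smul_mul_assoc]
        have key : ∀ {R : Type} [Ring R] (a e n : R), n = -1 → a + e = a - n * e := by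
          intro R _ a e n hn; rw [hn]; noncomm_ring
        exact key _ _ _ (by rw [map_neg, map_one])
      · rw [if_neg hi, if_neg hj, Equiv.swap_apply_of_ne_of_ne hi hj, swap_commute_hB β γ h hi hj,
          map_zero, zero_mul, smul_mul_assoc]
        exact (sub_zero _).symm
    have hE : ((1 / 2 : ℂ) • heckeRem β i j) * ρ (X l) = ρ (X l) * ((1 / 2 : ℂ) • heckeRem β i j) := by
      rw [hρ]
      exact (((heckeRem_commute_hB β γ i j l).smul_left _).smul_right _).eq
    have hq : swapQuot i j hij (p * X l)
        = swapHom i j p * swapQuot i j hij (X l) + swapQuot i j hij p * X l := by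
      rw [mul_comm p, swapQuot_mul]; ring
    rw [hq, map_mul, map_mul, map_mul, map_add, map_mul, map_mul]
    exact hecke_mul_aux hp hX hE

/-- The divided difference of an `s`-invariant polynomial is zero, so the correction term
disappears. -/
theorem swap_commute_aeval (hρ : ∀ i, ρ (X i) = (1 / 2 : ℂ) • hB β γ i) {i j : Fin N}
    (h : (i : ℕ) + 1 = j) {p : Poly N} (hp : swapHom i j p = p) :
    permOp (Equiv.swap i j) * ρ p = ρ p * permOp (Equiv.swap i j) := by
  have hij : j ≠ i := fun h' => by rw [h'] at h; omega
  have h1 := swap_mul_aeval hρ h hij p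
  have h3 : swapQuot i j hij p = 0 := divDiff_eq_of_mul_eq _ _ (by rw [hp]; simp)
  rw [hp, h3, map_zero, zero_mul] at h1
  exact h1.trans (sub_zero _)

end Hecke

/-! ### Alternating functionals and degree. -/

/-- A linear functional that vanishes on polynomials symmetric under some adjacent transposition
is alternating. -/
theorem map_rename_eq_sign_mul (l : Poly N →ₗ[ℂ] ℂ)
    (hl : ∀ i j : Fin N, (i : ℕ) + 1 = j → ∀ p, swapHom i j p = p → l p = 0)
    (π : Equiv.Perm (Fin N)) (p : Poly N) :
    l (rename π p) = ((Equiv.Perm.sign π : ℤ) : ℂ) * l p := by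
  cases N with
  | zero =>
    have : π = 1 := Subsingleton.elim _ _
    subst this
    simp
  | succ n =>
    have hπ : π ∈ Submonoid.closure
        (Set.range fun i : Fin n => Equiv.swap i.castSucc i.succ) := by
      rw [Equiv.Perm.mclosure_swap_castSucc_succ]; trivial
    induction hπ using Submonoid.closure_induction generalizing p with
    | mem x hx =>
      obtain ⟨i, rfl⟩ := hx
      -- `p + s p` is `s`-invariant, hence killed, so `s` acts by `-1`.
      have h1 := hl i.castSucc i.succ (by simp) (p + swapHom i.castSucc i.succ p) (by
        rw [map_add, swapHom_swapHom, add_comm p])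
      rw [map_add] at h1
      have hne : i.castSucc ≠ i.succ := (Fin.castSucc_lt_succ).ne
      rw [Equiv.Perm.sign_swap hne]
      have h2 : l (rename (Equiv.swap i.castSucc i.succ) p) = -l p :=
        eq_neg_of_add_eq_zero_right h1
      rw [h2]; simp
    | one => simp
    | mul x y _ _ hx hy =>
      have h1 : rename (x * y) p = rename x (rename y p) := by
        rw [rename_rename]; rfl
      rw [h1, hx, hy, Equiv.Perm.sign_mul]
      push_cast
      ring

/-- An alternating functional kills the monomials with a repeated exponent. -/
theorem map_monomial_eq_zero (l : Poly N →ₗ[ℂ] ℂ)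
    (hl : ∀ i j : Fin N, (i : ℕ) + 1 = j → ∀ p, swapHom i j p = p → l p = 0)
    {a : Fin N →₀ ℕ} {i j : Fin N} (hij : i ≠ j) (ha : a i = a j) (c : ℂ) :
    l (monomial a c) = 0 := by
  have h := map_rename_eq_sign_mul l hl (Equiv.swap i j) (monomial a c)
  have h1 : a.mapDomain (Equiv.swap i j) = a := by
    ext k
    rw [Finsupp.mapDomain_equiv_apply, Equiv.symm_swap, Equiv.swap_apply_def]
    split_ifs with h1 h2
    · rw [h1, ha]
    · rw [h2, ha]
    · rfl
  rw [rename_monomial, h1, Equiv.Perm.sign_swap hij] at h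
  simp only [Units.val_neg, Units.val_one, Int.cast_neg, Int.cast_one, neg_mul, one_mul] at h
  exact self_eq_neg.mp h

/-- Distinct natural numbers sum to at least `0 + 1 + … + (N - 1)`, the number of pairs. Thus a
monomial of smaller degree has a repeated exponent. -/
theorem length_pairList_le_sum (a : Fin N → ℕ) (ha : Function.Injective a) :
    (pairList N).length ≤ ∑ i, a i := by
  have hnd : (pairList N).Nodup :=
    ((List.nodup_finRange N).product (List.nodup_finRange N)).filter _
  have h1 : (pairList N).length
      = (Finset.univ.filter fun p : Fin N × Fin N => p.1 < p.2).card := by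
    rw [← List.toFinset_card_of_nodup hnd]
    congr 1
    ext p
    have h : p ∈ List.finRange N ×ˢ List.finRange N :=
      List.mem_product.mpr ⟨List.mem_finRange _, List.mem_finRange _⟩
    simp [pairList, h]
  have h2 : ∑ i, a i = (Finset.univ.sigma fun i => Finset.range (a i)).card := by
    simp [Finset.card_sigma]
  rw [h1, h2]
  -- A pair of indices goes to the index with the larger value, together with the smaller value;
  -- injectivity of `a` recovers the pair.
  refine Finset.card_le_card_of_injOn
    (fun p => if a p.1 < a p.2 then ⟨p.2, a p.1⟩ else ⟨p.1, a p.2⟩) ?_ ?_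
  · intro p hp
    have hp' : p.1 < p.2 := (Finset.mem_filter.mp hp).2
    have hne : a p.1 ≠ a p.2 := ha.ne hp'.ne
    dsimp only
    split_ifs with h
    · simpa using h
    · simp only [Finset.coe_sigma, Set.mem_sigma_iff]
      simp; omega
  · intro p hp q hq hpq
    have hp' : p.1 < p.2 := (Finset.mem_filter.mp hp).2
    have hq' : q.1 < q.2 := (Finset.mem_filter.mp hq).2
    dsimp only at hpq
    split_ifs at hpq with h h' h' <;> simp only [Sigma.mk.injEq, heq_eq_eq] at hpq
    · exact Prod.ext (ha hpq.2) hpq.1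
    · exfalso
      have h3 := ha hpq.2
      rw [hpq.1, h3] at hp'
      exact lt_asymm hp' hq'
    · exfalso
      have h3 := ha hpq.2
      rw [hpq.1, h3] at hp'
      exact lt_asymm hp' hq'
    · exact Prod.ext hpq.1 (ha hpq.2)

/-- The polynomial `∏_{i < j} (c - z_i + z_j)`. -/
noncomputable def shiftPoly (c : ℂ) (l : List (Fin N × Fin N)) : Poly N :=
  (l.map fun p => C c - X p.1 + X p.2).prod

theorem totalDegree_shiftFactor_le (c : ℂ) (p : Fin N × Fin N) :
    (C c - X p.1 + X p.2 : Poly N).totalDegree ≤ 1 := by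
  refine (totalDegree_add _ _).trans (max_le ((totalDegree_sub _ _).trans (max_le ?_ ?_)) ?_)
  · simp
  · simp
  · simp

theorem totalDegree_shiftPoly_le (c : ℂ) (l : List (Fin N × Fin N)) :
    (shiftPoly c l).totalDegree ≤ l.length := by
  induction l with
  | nil => simp [shiftPoly]
  | cons p l ih =>
    have h : shiftPoly c (p :: l) = (C c - X p.1 + X p.2) * shiftPoly c l := by simp [shiftPoly]
    rw [h, List.length_cons, add_comm l.length]
    exact (totalDegree_mul _ _).trans (add_le_add (totalDegree_shiftFactor_le c p) ih)

/-- The top-degree part is free of `c`. The zero alternative is needed for the empty list, where no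
degree is below `0`. -/
theorem shiftPoly_sub_eq_zero_or (c c' : ℂ) (l : List (Fin N × Fin N)) :
    shiftPoly c l - shiftPoly c' l = 0 ∨
      (shiftPoly c l - shiftPoly c' l).totalDegree < l.length := by
  induction l with
  | nil => left; simp [shiftPoly]
  | cons p l ih =>
    right
    have h : shiftPoly c (p :: l) - shiftPoly c' (p :: l)
        = (C c - X p.1 + X p.2) * (shiftPoly c l - shiftPoly c' l)
          + C (c - c') * shiftPoly c' l := by
      simp only [shiftPoly, List.map_cons, List.prod_cons, C_sub]; ring
    rw [h, List.length_cons, Nat.lt_succ_iff]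
    refine (totalDegree_add _ _).trans (max_le ?_ ((totalDegree_mul _ _).trans ?_))
    · rcases ih with ih | ih
      · rw [ih]; simp
      · refine (totalDegree_mul _ _).trans ?_
        have := totalDegree_shiftFactor_le c p
        omega
    · rw [totalDegree_C, zero_add]; exact totalDegree_shiftPoly_le c' l

/-- An alternating functional takes the same value on all `∏_{i < j} (c - z_i + z_j)`. -/
theorem map_shiftPoly_eq (l : Poly N →ₗ[ℂ] ℂ)
    (hl : ∀ i j : Fin N, (i : ℕ) + 1 = j → ∀ p, swapHom i j p = p → l p = 0) (c c' : ℂ) :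
    l (shiftPoly c (pairList N)) = l (shiftPoly c' (pairList N)) := by
  rw [← sub_eq_zero, ← map_sub]
  rcases shiftPoly_sub_eq_zero_or c c' (pairList N) with h | h
  · rw [h, map_zero]
  · set q := shiftPoly c (pairList N) - shiftPoly c' (pairList N)
    rw [q.as_sum, map_sum]
    refine Finset.sum_eq_zero fun a ha => ?_
    have h1 : ∑ i, a i < (pairList N).length := by
      have h2 := le_totalDegree ha
      rw [Finsupp.sum_fintype _ _ (fun _ => rfl)] at h2
      exact h2.trans_lt h
    have h2 : ¬ Function.Injective a := fun hinj =>
      absurd (length_pairList_le_sum a hinj) (not_le.mpr h1)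
    simp only [Function.Injective, not_forall] at h2
    obtain ⟨i, j, hij, hne⟩ := h2
    exact map_monomial_eq_zero l hl hne hij _

/-! ### Transfer of `𝒴` across the form. -/

theorem YL_eq_aeval {β : ℕ} {γ : ℝ} {ρ : Poly N →ₐ[ℂ] Module.End ℂ (Poly N)}
    (hρ : ∀ i, ρ (X i) = (1 / 2 : ℂ) • hB β γ i) (c : ℂ) :
    YL β γ c = ρ (shiftPoly c (pairList N)) := by
  rw [shiftPoly, map_list_prod, List.map_map, YL]
  congr 2
  funext p
  have h1 : ρ (C c) = c • 1 := by
    rw [← Algebra.algebraMap_eq_smul_one]; exact ρ.commutes c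
  rw [Function.comp_apply, map_add, map_sub, hρ, hρ, h1]

theorem aeval_form {β : ℕ} {γ : ℝ} {ρ : Poly N →ₐ[ℂ] Module.End ℂ (Poly N)}
    (hρ : ∀ i, ρ (X i) = (1 / 2 : ℂ) • hB β γ i) {L : Poly N →ₗ[ℂ] ℂ}
    (hL : IsWeightFunctional γ L) (p f g : Poly N) :
    L (ρ p f * g * XL N ^ (2 * β)) = L (f * ρ p g * XL N ^ (2 * β)) := by
  induction p using MvPolynomial.induction_on generalizing f g with
  | C a =>
    have h1 : ρ (C a) = a • 1 := by
      rw [← Algebra.algebraMap_eq_smul_one]; exact ρ.commutes a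
    rw [h1]
    simp
  | add p q hp hq =>
    rw [map_add, LinearMap.add_apply, LinearMap.add_apply, add_mul, add_mul, map_add, hp, hq,
      mul_add, add_mul, map_add]
  | mul_X p l hp =>
    have h1 : ρ (p * X l) g = ρ (X l) (ρ p g) := by rw [mul_comm, map_mul]; rfl
    have h2 : ρ (p * X l) f = ρ p (ρ (X l) f) := by rw [map_mul]; rfl
    rw [h1, h2, hp, hρ, LinearMap.smul_apply, LinearMap.smul_apply, smul_mul_assoc,
      smul_mul_assoc, mul_smul_comm, smul_mul_assoc, map_smul, map_smul, hL.hB_form]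

theorem YL_form {β : ℕ} {γ : ℝ} {L : Poly N →ₗ[ℂ] ℂ} (hL : IsWeightFunctional γ L) (c c' : ℂ)
    {f g : Poly N} (hf : f.IsSymmetric) (hg : g.IsSymmetric) :
    L (YL β γ c f * (XL N * g) * XL N ^ (2 * β))
      = L (f * shiftGHat β γ c' g * XL N ^ (2 * β)) := by
  obtain ⟨ρ, hρ⟩ := exists_aeval_of_commute (fun i : Fin N => (1 / 2 : ℂ) • hB β γ i)
    fun i j => ((hB_commute β γ i j).smul_left _).smul_right _
  set A : Poly N := XL N * g with hA
  -- Both sides will be values of this functional, at the shift polynomials for `c` and `c'`.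
  let l : Poly N →ₗ[ℂ] ℂ := L ∘ₗ mulOp (f * XL N ^ (2 * β)) ∘ₗ LinearMap.applyₗ A ∘ₗ ρ.toLinearMap
  have hlp : ∀ p, l p = L (f * ρ p A * XL N ^ (2 * β)) := fun p => by
    show L (f * XL N ^ (2 * β) * ρ p A) = _
    congr 1; ring
  have hl : ∀ i j : Fin N, (i : ℕ) + 1 = j → ∀ p, swapHom i j p = p → l p = 0 := by
    intro i j hij p hp
    have hne : i ≠ j := fun h' => by rw [h'] at hij; omega
    have hsA : rename (Equiv.swap i j) A = -A := by
      rw [hA, map_mul, rename_XL, hg, Equiv.Perm.sign_swap hne]; simp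
    have hc : rename (Equiv.swap i j) (ρ p A) = -ρ p A := by
      have h1 : rename (Equiv.swap i j) (ρ p A) = ρ p (rename (Equiv.swap i j) A) :=
        LinearMap.congr_fun (swap_commute_aeval hρ hij hp) A
      rw [h1, hsA, map_neg]
    -- The argument is antisymmetric under the swap, so invariance of `L` gives `l p = -l p`.
    have h2 := hL.rename (Equiv.swap i j) (f * ρ p A * XL N ^ (2 * β))
    rw [map_mul (rename _), map_mul (rename _), hc, hf, rename_XL_pow, mul_neg, neg_mul,
      map_neg] at h2
    rw [hlp]
    exact CharZero.neg_eq_self_iff.mp h2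
  have h3 : shiftGHat β γ c' g = ρ (shiftPoly c' (pairList N)) A := by
    rw [← YL_eq_aeval hρ]; rfl
  rw [YL_eq_aeval hρ, aeval_form hρ hL, h3, ← hlp, ← hlp]
  exact map_shiftPoly_eq l hl c c'

end Laguerre

theorem mainTheorem9 (N β : ℕ) (γ : ℝ) (hγ : -1 / 2 < γ) (ε : ℂ) (hε : ε = 1 ∨ ε = -1)
    (f g : Laguerre.Poly N) (hf : f ∈ Laguerre.evenSymm N) (hg : g ∈ Laguerre.evenSymm N) :
    MeasureTheory.Integrable
        (Laguerre.integrandL (β + 1) γ (Laguerre.shiftG β γ (ε * β) f) (Laguerre.toFn g)) ∧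
      MeasureTheory.Integrable
        (Laguerre.integrandL β γ (Laguerre.toFn f)
          (Laguerre.toFn (Laguerre.shiftGHat β γ (-(ε * β)) g))) ∧
      Laguerre.innerL (β + 1) γ (Laguerre.shiftG β γ (ε * β) f) (Laguerre.toFn g) =
        Laguerre.innerL β γ (Laguerre.toFn f)
          (Laguerre.toFn (Laguerre.shiftGHat β γ (-(ε * β)) g)) := by
  have hL := Laguerre.isWeightFunctional (N := N) hγ
  have hG : Laguerre.integrandL (β + 1) γ (Laguerre.shiftG β γ (ε * β) f) (Laguerre.toFn g)
      = Laguerre.integrandL β γ (Laguerre.toFn (Laguerre.YL β γ (ε * β) f))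
        (Laguerre.toFn (Laguerre.XL N * g)) :=
    funext (Laguerre.integrandL_shiftG β γ (ε * β) f g)
  have hI : Laguerre.innerL (β + 1) γ (Laguerre.shiftG β γ (ε * β) f) (Laguerre.toFn g)
      = Laguerre.innerL β γ (Laguerre.toFn (Laguerre.YL β γ (ε * β) f))
        (Laguerre.toFn (Laguerre.XL N * g)) := by
    rw [Laguerre.innerL, hG, Laguerre.innerL]
  refine ⟨?_, Laguerre.integrable_integrandL_toFn β hγ _ _, ?_⟩
  · rw [hG]
    exact Laguerre.integrable_integrandL_toFn β hγ _ _
  · rw [hI, Laguerre.innerL_toFn β hγ, Laguerre.innerL_toFn β hγ]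
    -- An instance of a statement valid for arbitrary constants, which is why either sign `ε` is
    -- allowed.
    exact Laguerre.YL_form hL (ε * β) (-(ε * β)) hf.2 hg.2
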